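/- **Theorem (Equivalence of Ensembles).** Let $0<q<1$, put $a=2|\ln q|$, let $L\ge 0$ be an even integer, and for $x=(x^1,x^2,x^3)\in\mathbb Z^3$ let $l(x)=x^1+x^2+x^3$. Let $\Sigma$ be the set of the sites $x$ with $-L/2\le l(x)\le L/2$ on the stick $\dots,-e_2-e_3,-e_3,0,e_1,e_1+e_2,e_1+e_2+e_3,e_1+e_2+e_3+e_1,\dots$ in $\mathbb Z^3$. Let $\Gamma_0,\Gamma$ be finite subsets of the plane $l(x)=0$, $A_0=|\Gamma_0|$, $A=|\Gamma|$, and let $\Lambda_0=\Gamma_0+\Sigma$ and $\Lambda=\Gamma+\Sigma$ be the cylindrical volumes with these bases, so that $|\Lambda_0|=A_0(L+1)$ and $|\Lambda|=A(L+1)$. Suppose that $\Lambda_0\subset\Lambda$. For a finite volume $V\subset\mathbb Z^3$, let $|\alpha\rangle$, $\alpha\in\{0,1\}^V$, be the standard basis of $(\mathbb C^2)^{\otimes V}$, where $0$ stands for spin up $\uparrow$ (an empty site) and $1$ for spin down $\downarrow$ (an occupied site). Let $\mathsf N|\alpha\rangle=\big(\sum_{x\in V}\alpha(x)\big)|\alpha\rangle$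 and $J^{(3)}=\sum_{x\in V}S^{(3)}_x$ with $S^{(3)}=\mathrm{diag}(\tfrac12,-\tfrac12)$. The canonical ($n$-particle) interface ground states of the XXZ model and the grand canonical product states are $$\psi_0(V,n)=\sum_{\alpha:\ \sum_x\alpha(x)=n}\ \bigotimes_{x\in V}q^{l(x)\alpha(x)}|\alpha(x)\rangle,\qquad \psi^{GC}(V,\mu)=\bigotimes_{x\in V}\big(|{\uparrow}\rangle+q^{l(x)-\mu}|{\downarrow}\rangle\big),$$ and $\langle X\rangle_{V,n}$, $\langle X\rangle^{GC}_{V,\mu}$ denote the corresponding normalized expectations $\langle\psi|X|\psi\rangle/\langle\psi|\psi\rangle$. For an operator $X$ on $(\mathbb C^2)^{\otimes\Lambda_0}$ put $$\|X\|_{gs}=\sup_{0\le m\le|\Lambda_0|}|\langle X\rangle_{\Lambda_0,m}|.$$ Let $n$ be an integer with $0<n<|\Lambda|$, put $\rho=n/|\Lambda|$, and suppose that $q^2(A-A_0)^{1/2}>2A_0$. Then there is exactly one $\mu\in\mathbb R$ with $$\langle\mathsf N\rangle^{GC}_{\Sigma,\mu}=\rho\,(L+1),$$ and for this $\mu$ every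 operator $X$ on $(\mathbb C^2)^{\otimes\Lambda_0}$ that commutes with $J^{(3)}$ satisfies, with $X$ identified with $X\otimes 1$ on $(\mathbb C^2)^{\otimes\Lambda}$, $$\big|\langle X\rangle_{\Lambda,n}-\langle X\rangle^{GC}_{\Lambda_0,\mu}\big|\le\varepsilon\,\|X\|_{gs},\qquad \varepsilon=\frac{\ln^2(A-A_0)+2(1+a^2)A_0^2+4}{2(A-A_0)}+\frac{4A_0}{q^2(A-A_0)^{1/2}-2A_0}.$$ In particular, $\mu=0$ if $\rho=1/2$. -/

import Mathlib

namespace XXZ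

open Matrix

noncomputable section

/-! ### Geometry of the 111 direction in `ℤ³` -/

/-- Sites of the lattice `ℤ³`. -/
abbrev Site : Type := Fin 3 → ℤ

/-- The signed height `l(x) = x¹ + x² + x³`. -/
def height (x : Site) : ℤ := x 0 + x 1 + x 2

/-- The unique site of height `m` on the infinite stick
`…, -e₂-e₃, -e₃, 0, e₁, e₁+e₂, e₁+e₂+e₃, e₁+e₂+e₃+e₁, …`
(integer division rounds down). -/
def stickSite (m : ℤ) : Site := ![(m + 2) / 3, (m + 1) / 3, m / 3]

theorem stickSite_zero : stickSite 0 = 0 := by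
  funext i
  fin_cases i <;> simp [stickSite]

/-- Consecutive sites of the stick differ by `e₁, e₂, e₃`, cyclically. -/
theorem stickSite_add_one (k : ℤ) :
    stickSite (3 * k + 1) = stickSite (3 * k) + ![1, 0, 0] ∧
    stickSite (3 * k + 2) = stickSite (3 * k + 1) + ![0, 1, 0] ∧
    stickSite (3 * k + 3) = stickSite (3 * k + 2) + ![0, 0, 1] := by
  refine ⟨?_, ?_, ?_⟩ <;> funext i <;> fin_cases i <;> simp [stickSite] <;> omega

theorem height_stickSite (m : ℤ) : height (stickSite m) = m := by
  simp [height, stickSite]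
  omega

/-- The finite stick `Σ₀`: the sites of the infinite stick with `-L/2 ≤ l(x) ≤ L/2`
(`L` is even wherever this is used). -/
def stick (L : ℕ) : Finset Site :=
  (Finset.Icc (-((L : ℤ) / 2)) ((L : ℤ) / 2)).image stickSite

/-- The cylindrical volume `Λ = {x + y ∣ x ∈ Γ, y ∈ Σ₀}` with base `Γ`. -/
def cylinder (L : ℕ) (Γ : Finset Site) : Finset Site :=
  (Γ ×ˢ stick L).image fun p => p.1 + p.2

/-! ### Spin-1/2 systems on a finite volume

The Hilbert space `(ℂ²)^{⊗Λ}` is the space of functions on particle configurations; operators on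
it are matrices in the orthonormal basis `|α⟩`. -/

/-- Particle configurations: `0` is spin up (empty), `1` is spin down (occupied). -/
abbrev Config (Λ : Finset Site) : Type := ↥Λ → Fin 2

/-- Vectors of `(ℂ²)^{⊗Λ}`, by their coordinates in the basis `|α⟩`. -/
abbrev StateVec (Λ : Finset Site) : Type := Config Λ → ℂ

/-- Linear operators on `(ℂ²)^{⊗Λ}`. -/
abbrev Observable (Λ : Finset Site) : Type := Matrix (Config Λ) (Config Λ) ℂ

/-- The number of particles of a configuration. -/
def numParticles {Λ : Finset Site} (α : Config Λ) : ℕ := ∑ x, (α x : ℕ)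

/-- The particle number operator `N`. -/
def numberOp (Λ : Finset Site) : Observable Λ :=
  Matrix.diagonal fun α => (numParticles α : ℂ)

/-- The one-site spin matrix `S⁽³⁾`. -/
def spin3 : Matrix (Fin 2) (Fin 2) ℂ := !![1 / 2, 0; 0, -1 / 2]

/-- The one-site operator `M` acting at the site `x`, tensored with the identity elsewhere. -/
def siteOp {Λ : Finset Site} (x : ↥Λ) (M : Matrix (Fin 2) (Fin 2) ℂ) : Observable Λ :=
  Matrix.of fun α β => if ∀ y, y ≠ x → α y = β y then M (α x) (β x) else 0

/-- The third component of the total spin, `J⁽³⁾ = ∑ₓ Sₓ⁽³⁾`. -/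
def totalSpin3 (Λ : Finset Site) : Observable Λ := ∑ x : ↥Λ, siteOp x spin3

/-- Restriction of a configuration to a subvolume. -/
def restrictConfig {Λ₀ Λ : Finset Site} (h : Λ₀ ⊆ Λ) (α : Config Λ) : Config Λ₀ :=
  fun x => α ⟨x.1, h x.2⟩

/-- An operator `X` localized in `Λ₀`, regarded as the operator `X ⊗ 1` on the volume `Λ ⊇ Λ₀`. -/
def ampliation {Λ₀ Λ : Finset Site} (h : Λ₀ ⊆ Λ) (X : Observable Λ₀) : Observable Λ :=
  Matrix.of fun α β =>
    if ∀ x : ↥Λ, x.1 ∉ Λ₀ → α x = β x then X (restrictConfig h α) (restrictConfig h β) else 0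

/-- The expectation `⟨ψ|X|ψ⟩ / ⟨ψ|ψ⟩`. -/
def expectation {Λ : Finset Site} (ψ : StateVec Λ) (X : Observable Λ) : ℂ :=
  (star ψ ⬝ᵥ (X *ᵥ ψ)) / (star ψ ⬝ᵥ ψ)

/-! ### Canonical and grand canonical interface states -/

/-- The canonical ground state `ψ₀(Λ,n) = ∑_{α : N(α) = n} ⨂ₓ q^{l(x)α(x)} |α(x)⟩`. -/
def canonicalState (q : ℝ) (Λ : Finset Site) (n : ℕ) : StateVec Λ :=
  fun α => if numParticles α = n then ((∏ x, q ^ (height x.1 * ((α x : ℕ) : ℤ)) : ℝ) : ℂ) else 0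

/-- The grand canonical product state `⨂ₓ (|↑⟩ + q^{l(x)-μ} |↓⟩)`. -/
def gcState (q : ℝ) (Λ : Finset Site) (μ : ℝ) : StateVec Λ :=
  fun α => ((∏ x, (if α x = 1 then q ^ ((height x.1 : ℝ) - μ) else 1) : ℝ) : ℂ)

/-- The canonical expectation of `X` in the state with `n` particles. -/
def canonicalExp (q : ℝ) (Λ : Finset Site) (n : ℕ) (X : Observable Λ) : ℂ :=
  expectation (canonicalState q Λ n) X

/-- The grand canonical expectation of `X` at chemical potential `μ`. -/
def gcExp (q : ℝ) (Λ : Finset Site) (μ : ℝ) (X : Observable Λ) : ℂ :=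
  expectation (gcState q Λ μ) X

/-- `‖X‖_gs = sup_{0 ≤ n ≤ |Λ|} |⟨X⟩_{Λ,n}|` for an observable `X` localized in `Λ`. -/
def gsNorm (q : ℝ) (Λ : Finset Site) (X : Observable Λ) : ℝ :=
  ⨆ n : Fin (Λ.card + 1), ‖canonicalExp q Λ n X‖

/-- The chemical potential `μ` solves `⟨N⟩^{GC}_{Σ,μ} = ρ (L+1)`. -/
def IsChemicalPotential (q : ℝ) (L : ℕ) (ρ μ : ℝ) : Prop :=
  gcExp q (stick L) μ (numberOp (stick L)) = ((ρ * (L + 1) : ℝ) : ℂ)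

/-- The error term `ε`, with `a = 2 |ln q|`. -/
def errorBound (q A A₀ : ℝ) : ℝ :=
  (Real.log (A - A₀) ^ 2 + 2 * (1 + (2 * |Real.log q|) ^ 2) * A₀ ^ 2 + 4) / (2 * (A - A₀))
    + 4 * A₀ / (q ^ 2 * √(A - A₀) - 2 * A₀)

end

end XXZ

namespace XXZ

open Polynomial

noncomputable section

/-! ### Sums of independent Bernoulli variables -/

/-! The grand canonical state is a product state with independent occupation numbers, and the
canonical state is its `n`-particle component. Let `S₀`, `S'` and `S = S₀ + S'` be the particle
numbers in `Λ₀`, `Λ \ Λ₀` and `Λ`. An observable that conserves the particle number sees only the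
sectors of `Λ₀`: its grand canonical expectation weights the `m`-particle expectation by `P(S₀ =
m)`, its canonical one by `P(S₀ = m) P(S' = n - m) / P(S = n)`. So `ε` has to dominate the mean over
`S₀` of `|P(S' = n - m) - P(S = n)|`, divided by `P(S = n)`.

Numerator (`sum_coeff_mul_abs_sub_le`): `P(S = n)` is the `S₀`-mean of `r(m) = P(S' = n - m)`, and
by Fourier inversion `r` extends to a function with Lipschitz constant `π / (4 Var S')`. Hence the
mean oscillation is at most this constant times the standard deviation of `S₀`.

Denominator (`centralConst_div_sqrt_le_coeff`): the choice of `μ` gives `S` the integer mean `n`,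
and then `P(S = n) ≥ c / √(Var S)`. An extremal argument over all parameters with the given mean
reduces this to the binomial law, where Stirling's formula applies.

All three variances are multiples of the variance of one stick, with factors `A₀`, `A - A₀` and `A`.
The stick variance cancels, leaving a constant times `√(A₀ A) / (A - A₀)`, which is below the second
term of `ε`. -/

/-- The probability generating function of the sum of independent Bernoulli variables with
success probabilities `p i`, `i ∈ s`. -/
def bernoulliGF {ι : Type*} (p : ι → ℝ) (s : Finset ι) : ℝ[X] :=
  ∏ i ∈ s, (C (1 - p i) + C (p i) * X)

/-- The variance of the sum of independent Bernoulli variables. -/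
def bernoulliVar {ι : Type*} (p : ι → ℝ) (s : Finset ι) : ℝ :=
  ∑ i ∈ s, p i * (1 - p i)

theorem natDegree_bernoulliGF_le {ι : Type*} (p : ι → ℝ) (s : Finset ι) :
    (bernoulliGF p s).natDegree ≤ s.card := by
  refine (natDegree_prod_le _ _).trans ?_
  rw [Finset.card_eq_sum_ones]
  refine Finset.sum_le_sum fun i _ => ?_
  compute_degree

/-- The weighted sum `∑ₖ fₖ h(k)` over the coefficients of a polynomial. -/
def coeffPairing (h : ℕ → ℝ) : ℝ[X] →ₗ[ℝ] ℝ :=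
  lsum fun k => h k • LinearMap.id

theorem coeffPairing_monomial (h : ℕ → ℝ) (k : ℕ) (a : ℝ) :
    coeffPairing h (monomial k a) = h k * a := by
  simp [coeffPairing, lsum_apply, sum_monomial_index]

theorem coeffPairing_eq_sum_range (h : ℕ → ℝ) {f : ℝ[X]} {N : ℕ} (hN : f.natDegree ≤ N) :
    coeffPairing h f = ∑ k ∈ Finset.range (N + 1), f.coeff k * h k := by
  rw [coeffPairing, lsum_apply, sum_over_range' f _ (N + 1) (by omega)]
  · simp [mul_comm]
  · simp

/-- Conditioning on one further trial: a success shifts the count by one. -/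
theorem coeffPairing_mul_linear (h : ℕ → ℝ) (f : ℝ[X]) (a b : ℝ) :
    coeffPairing h (f * (C a + C b * X)) =
      a * coeffPairing h f + b * coeffPairing (fun k => h (k + 1)) f := by
  induction f using Polynomial.induction_on' with
  | add f g hf hg => rw [add_mul, map_add, hf, hg, map_add, map_add]; ring
  | monomial k c =>
    have : monomial k c * (C a + C b * X) = monomial k (c * a) + monomial (k + 1) (c * b) := by
      rw [mul_add, monomial_mul_C, ← mul_assoc, monomial_mul_C, monomial_mul_X]
    rw [this, map_add]
    simp only [coeffPairing_monomial]
    ring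

/-- The centre `y` is free because a success of the added trial turns it into `y - 1` in the
induction. -/
theorem coeffPairing_sq_bernoulliGF {ι : Type*} (p : ι → ℝ) (s : Finset ι) (y : ℝ) :
    coeffPairing (fun k => ((k : ℝ) - y) ^ 2) (bernoulliGF p s) =
      bernoulliVar p s + (∑ i ∈ s, p i - y) ^ 2 := by
  classical
  induction s using Finset.induction_on generalizing y with
  | empty =>
    have : bernoulliGF p ∅ = monomial 0 1 := by simp [bernoulliGF]
    rw [this, coeffPairing_monomial]
    simp [bernoulliVar]
  | insert i s hi ih =>
    have h1 : bernoulliGF p (insert i s) =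
        bernoulliGF p s * (C (1 - p i) + C (p i) * X) := by
      rw [bernoulliGF, Finset.prod_insert hi, mul_comm, bernoulliGF]
    have h2 : (fun k : ℕ => (((k + 1 : ℕ) : ℝ) - y) ^ 2) =
        fun k : ℕ => ((k : ℝ) - (y - 1)) ^ 2 := by
      funext k; push_cast; ring
    rw [h1, coeffPairing_mul_linear, h2, ih, ih, bernoulliVar, bernoulliVar,
      Finset.sum_insert hi, Finset.sum_insert hi]
    ring

theorem sum_coeff_mul_sq_bernoulliGF {ι : Type*} (p : ι → ℝ) (s : Finset ι) :
    ∑ k ∈ Finset.range (s.card + 1),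
      (bernoulliGF p s).coeff k * ((k : ℝ) - ∑ i ∈ s, p i) ^ 2 = bernoulliVar p s := by
  rw [← coeffPairing_eq_sum_range (fun k : ℕ => ((k : ℝ) - ∑ i ∈ s, p i) ^ 2)
    (natDegree_bernoulliGF_le p s), coeffPairing_sq_bernoulliGF]
  ring

theorem sum_coeff_bernoulliGF {ι : Type*} (p : ι → ℝ) (s : Finset ι) :
    ∑ k ∈ Finset.range (s.card + 1), (bernoulliGF p s).coeff k = 1 := by
  have h := eval_eq_sum_range' (Nat.lt_succ_of_le (natDegree_bernoulliGF_le p s)) 1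
  simp only [one_pow, mul_one] at h
  rw [← Nat.succ_eq_add_one, ← h, bernoulliGF, eval_prod]
  simp

theorem coeff_bernoulliGF_nonneg {ι : Type*} {p : ι → ℝ} {s : Finset ι}
    (hp : ∀ i ∈ s, 0 ≤ p i ∧ p i ≤ 1) (k : ℕ) : 0 ≤ (bernoulliGF p s).coeff k := by
  classical
  induction s using Finset.induction_on generalizing k with
  | empty => simp only [bernoulliGF, Finset.prod_empty, coeff_one]; split_ifs <;> norm_num
  | insert i s hi ih =>
    have h0 := hp i (Finset.mem_insert_self i s)
    have ih' := ih fun j hj => hp j (Finset.mem_insert_of_mem hj)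
    rw [bernoulliGF, Finset.prod_insert hi, add_mul, coeff_add, coeff_C_mul, mul_assoc,
      coeff_C_mul]
    refine add_nonneg (mul_nonneg (by linarith) (ih' k)) (mul_nonneg h0.1 ?_)
    cases k with
    | zero => simp
    | succ k => rw [coeff_X_mul]; exact ih' k

/-! ### Fourier analysis of the coefficients -/

/-- The squared modulus is `1 - 2p(1-p)(1 - cos θ)`; then use `1 - cos θ ≥ 2θ²/π²` on `[-π, π]` and
`1 - x ≤ e^{-x}`. -/
theorem norm_one_sub_add_mul_exp_le {p : ℝ} (h0 : 0 ≤ p) (h1 : p ≤ 1) {θ : ℝ}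
    (hθ : |θ| ≤ Real.pi) :
    ‖((1 - p : ℝ) : ℂ) + (p : ℂ) * Complex.exp (θ * Complex.I)‖ ≤
      Real.exp (-(2 / Real.pi ^ 2 * (p * (1 - p)) * θ ^ 2)) := by
  have hsq : ‖((1 - p : ℝ) : ℂ) + (p : ℂ) * Complex.exp (θ * Complex.I)‖ ^ 2 =
      1 - 2 * (p * (1 - p)) * (1 - Real.cos θ) := by
    rw [← Complex.normSq_eq_norm_sq, Complex.exp_mul_I, ← Complex.ofReal_cos, ← Complex.ofReal_sin,
      Complex.normSq_apply]
    simp only [Complex.add_re, Complex.add_im, Complex.mul_re, Complex.mul_im, Complex.ofReal_re,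
      Complex.ofReal_im, Complex.I_re, Complex.I_im]
    linear_combination p ^ 2 * Real.sin_sq_add_cos_sq θ
  have hcos := Real.cos_le_one_sub_mul_cos_sq hθ
  have hp : 0 ≤ p * (1 - p) := mul_nonneg h0 (by linarith)
  refine (sq_le_sq₀ (by positivity) (Real.exp_nonneg _)).1 ?_
  rw [hsq, ← Real.exp_nat_mul]
  refine le_trans ?_ (Real.add_one_le_exp _)
  push_cast
  nlinarith [mul_le_mul_of_nonneg_left hcos hp]

theorem norm_eval_bernoulliGF_le {ι : Type*} {p : ι → ℝ} {s : Finset ι}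
    (hp : ∀ i ∈ s, 0 ≤ p i ∧ p i ≤ 1) {θ : ℝ} (hθ : |θ| ≤ Real.pi) :
    ‖((bernoulliGF p s).map Complex.ofRealHom).eval (Complex.exp (θ * Complex.I))‖ ≤
      Real.exp (-(2 / Real.pi ^ 2 * bernoulliVar p s * θ ^ 2)) := by
  have h : Real.exp (-(2 / Real.pi ^ 2 * bernoulliVar p s * θ ^ 2)) =
      ∏ i ∈ s, Real.exp (-(2 / Real.pi ^ 2 * (p i * (1 - p i)) * θ ^ 2)) := by
    rw [← Real.exp_sum, bernoulliVar, Finset.sum_neg_distrib, Finset.mul_sum, Finset.sum_mul]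
  rw [h, bernoulliGF, Polynomial.map_prod, eval_prod, norm_prod]
  refine Finset.prod_le_prod (fun _ _ => norm_nonneg _) fun i hi => ?_
  simpa using norm_one_sub_add_mul_exp_le (hp i hi).1 (hp i hi).2 hθ

/-- The Fourier transform of `θ ↦ f(e^{iθ})` at the real frequency `t`. -/
def fourierAt (f : ℝ[X]) (t : ℝ) : ℂ :=
  ∫ θ in (-Real.pi)..Real.pi, (f.map Complex.ofRealHom).eval (Complex.exp (θ * Complex.I)) *
    Complex.exp (Complex.I * ((-(t * θ) : ℝ) : ℂ))

theorem integral_exp_int_mul_I (k : ℤ) :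
    ∫ θ in (-Real.pi)..Real.pi, Complex.exp ((k : ℂ) * Complex.I * θ) =
      if k = 0 then 2 * (Real.pi : ℂ) else 0 := by
  split_ifs with hk
  · subst hk
    simp
    ring
  · have hc : (k : ℂ) * Complex.I ≠ 0 := by simp [hk, Complex.I_ne_zero]
    rw [integral_exp_mul_complex hc]
    have : Complex.exp ((k : ℂ) * Complex.I * (Real.pi : ℝ)) =
        Complex.exp ((k : ℂ) * Complex.I * ((-Real.pi : ℝ) : ℂ)) := by
      rw [Complex.exp_eq_exp_iff_exists_int]
      exact ⟨k, by push_cast; ring⟩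
    rw [this, sub_self, zero_div]

/-- Orthogonality of the characters. Thus `fourierAt` interpolates `m ↦ P(S' = n - m)` to real
arguments, so that it can be evaluated at a mean that is not an integer. -/
theorem fourierAt_int (f : ℝ[X]) (n m : ℕ) :
    fourierAt f ((n : ℝ) - m) =
      2 * Real.pi * ((if m ≤ n then f.coeff (n - m) else 0 : ℝ) : ℂ) := by
  have h1 : ∀ θ : ℝ, (f.map Complex.ofRealHom).eval (Complex.exp (θ * Complex.I)) *
      Complex.exp (Complex.I * ((-(((n : ℝ) - m) * θ) : ℝ) : ℂ)) =
      ∑ j ∈ Finset.range (f.natDegree + 1),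
        (f.coeff j : ℂ) * Complex.exp ((((j : ℤ) + m - n : ℤ) : ℂ) * Complex.I * θ) := by
    intro θ
    rw [eval_eq_sum_range' (n := f.natDegree + 1)
      (Nat.lt_succ_of_le natDegree_map_le), Finset.sum_mul]
    refine Finset.sum_congr rfl fun j _ => ?_
    rw [coeff_map, Complex.ofRealHom_eq_coe, mul_assoc, ← Complex.exp_nat_mul, ← Complex.exp_add]
    congr 2
    push_cast
    ring
  rw [fourierAt]
  simp_rw [h1]
  rw [intervalIntegral.integral_finsetSum]
  · simp_rw [intervalIntegral.integral_const_mul, integral_exp_int_mul_I]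
    split_ifs with hmn
    · rw [Finset.sum_eq_single (n - m)]
      · rw [if_pos (by omega)]; ring
      · intro j _ hj
        rw [if_neg (by omega), mul_zero]
      · intro hj
        rw [coeff_eq_zero_of_natDegree_lt (by rw [Finset.mem_range] at hj; omega)]
        simp
    · rw [Finset.sum_eq_zero]
      · simp
      · intro j _
        rw [if_neg (by omega), mul_zero]
  · intro j _
    exact Continuous.intervalIntegrable (by fun_prop) _ _

theorem integral_abs_mul_exp_neg_sq_le {c : ℝ} (hc : 0 < c) {R : ℝ} (hR : 0 ≤ R) :
    ∫ θ in (-R)..R, |θ| * Real.exp (-(c * θ ^ 2)) ≤ 1 / c := by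
  have hint : ∀ a b : ℝ, IntervalIntegrable (fun θ : ℝ => |θ| * Real.exp (-(c * θ ^ 2)))
      MeasureTheory.volume a b := fun a b => Continuous.intervalIntegrable (by fun_prop) _ _
  have hpos : ∫ θ in (0 : ℝ)..R, |θ| * Real.exp (-(c * θ ^ 2)) ≤ 1 / (2 * c) := by
    have h1 : ∫ θ in (0 : ℝ)..R, |θ| * Real.exp (-(c * θ ^ 2)) =
        ∫ θ in (0 : ℝ)..R, θ * Real.exp (-(c * θ ^ 2)) := by
      refine intervalIntegral.integral_congr fun θ hθ => ?_
      rw [Set.uIcc_of_le hR] at hθ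
      simp only [abs_of_nonneg hθ.1]
    have h2 : ∫ θ in (0 : ℝ)..R, θ * Real.exp (-(c * θ ^ 2)) =
        (-(1 / (2 * c)) * Real.exp (-(c * R ^ 2))) -
          (-(1 / (2 * c)) * Real.exp (-(c * (0 : ℝ) ^ 2))) := by
      refine intervalIntegral.integral_eq_sub_of_hasDerivAt
        (f := fun θ => -(1 / (2 * c)) * Real.exp (-(c * θ ^ 2))) (fun θ _ => ?_)
        (Continuous.intervalIntegrable (by fun_prop) _ _)
      have := ((((hasDerivAt_id θ).pow 2).const_mul c).neg.exp).const_mul (-(1 / (2 * c)))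
      convert! this using 1
      simp
      field_simp
    rw [h1, h2]
    have := mul_nonneg (by positivity : 0 ≤ 1 / (2 * c)) (Real.exp_nonneg (-(c * R ^ 2)))
    simp only [ne_eq, OfNat.ofNat_ne_zero, not_false_eq_true, zero_pow, mul_zero, neg_zero,
      Real.exp_zero]
    linarith
  have hneg : ∫ θ in (-R)..0, |θ| * Real.exp (-(c * θ ^ 2)) =
      ∫ θ in (0 : ℝ)..R, |θ| * Real.exp (-(c * θ ^ 2)) := by
    have := intervalIntegral.integral_comp_neg (a := 0) (b := R)
      (fun θ : ℝ => |θ| * Real.exp (-(c * θ ^ 2)))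
    simp only [abs_neg, neg_sq, neg_zero] at this
    exact this.symm
  rw [← intervalIntegral.integral_add_adjacent_intervals (hint (-R) 0) (hint 0 R), hneg]
  have : 1 / c = 1 / (2 * c) + 1 / (2 * c) := by field_simp; norm_num
  linarith

/-- The two characters differ by at most `|t - u| |θ|`, and the Gaussian bound on the generating
function makes `|θ|` integrable with integral at most `1 / c`. -/
theorem norm_fourierAt_sub_le {ι : Type*} {p : ι → ℝ} {s : Finset ι}
    (hp : ∀ i ∈ s, 0 ≤ p i ∧ p i ≤ 1) (hV : 0 < bernoulliVar p s) (t u : ℝ) :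
    ‖fourierAt (bernoulliGF p s) t - fourierAt (bernoulliGF p s) u‖ ≤
      Real.pi ^ 2 / (2 * bernoulliVar p s) * |t - u| := by
  have hpi := Real.pi_pos
  set c := 2 / Real.pi ^ 2 * bernoulliVar p s with hc
  have hc0 : 0 < c := by positivity
  have hcont : ∀ t : ℝ, Continuous fun θ : ℝ =>
      ((bernoulliGF p s).map Complex.ofRealHom).eval (Complex.exp (θ * Complex.I)) *
        Complex.exp (Complex.I * ((-(t * θ) : ℝ) : ℂ)) := fun t => by
    refine Continuous.mul ?_ (by fun_prop)
    exact (Polynomial.continuous _).comp (by fun_prop)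
  rw [fourierAt, fourierAt, ← intervalIntegral.integral_sub
    ((hcont t).intervalIntegrable _ _) ((hcont u).intervalIntegrable _ _)]
  refine (intervalIntegral.norm_integral_le_of_norm_le
    (g := fun θ => |t - u| * (|θ| * Real.exp (-(c * θ ^ 2)))) (by linarith) ?_
    (Continuous.intervalIntegrable (by fun_prop) _ _)).trans ?_
  · refine Filter.Eventually.of_forall fun θ hθ => ?_
    have hθ' : |θ| ≤ Real.pi := abs_le.2 ⟨hθ.1.le, hθ.2⟩
    have he : ‖Complex.exp (Complex.I * ((-(t * θ) : ℝ) : ℂ)) -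
        Complex.exp (Complex.I * ((-(u * θ) : ℝ) : ℂ))‖ ≤ |t - u| * |θ| := by
      have : Complex.exp (Complex.I * ((-(t * θ) : ℝ) : ℂ)) =
          Complex.exp (Complex.I * ((-(u * θ) : ℝ) : ℂ)) *
            Complex.exp (Complex.I * ((-((t - u) * θ) : ℝ) : ℂ)) := by
        rw [← Complex.exp_add]; congr 1; push_cast; ring
      rw [this, ← mul_sub_one, norm_mul, Complex.norm_exp_I_mul_ofReal, one_mul, ← abs_mul]
      refine Real.norm_exp_I_mul_ofReal_sub_one_le.trans ?_
      rw [Real.norm_eq_abs, abs_neg]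
    rw [← mul_sub, norm_mul]
    calc _ ≤ Real.exp (-(c * θ ^ 2)) * (|t - u| * |θ|) :=
          mul_le_mul (norm_eval_bernoulliGF_le hp hθ') he (norm_nonneg _) (Real.exp_nonneg _)
      _ = _ := by ring
  · rw [intervalIntegral.integral_const_mul, mul_comm]
    refine mul_le_mul_of_nonneg_right ?_ (abs_nonneg _)
    refine (integral_abs_mul_exp_neg_sq_le hc0 hpi.le).trans (le_of_eq ?_)
    rw [hc]
    field_simp

/-- The mean oscillation of `m ↦ P(S' = n - m)` under the law of an independent Bernoulli sum. -/
theorem sum_coeff_mul_abs_sub_le {ι κ : Type*} {p : ι → ℝ} {s : Finset ι} {p' : κ → ℝ}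
    {s' : Finset κ} (hp : ∀ i ∈ s, 0 ≤ p i ∧ p i ≤ 1) (hp' : ∀ i ∈ s', 0 ≤ p' i ∧ p' i ≤ 1)
    (hV : 0 < bernoulliVar p' s') (n : ℕ) (r : ℕ → ℝ)
    (hr : ∀ m, r m = if m ≤ n then (bernoulliGF p' s').coeff (n - m) else 0) (rbar : ℝ)
    (hrbar : ∑ m ∈ Finset.range (s.card + 1), (bernoulliGF p s).coeff m * r m = rbar) :
    ∑ m ∈ Finset.range (s.card + 1), (bernoulliGF p s).coeff m * |r m - rbar| ≤
      Real.pi / (4 * bernoulliVar p' s') * √(bernoulliVar p s) := by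
  have hpi := Real.pi_pos
  set w := (bernoulliGF p s).coeff with hw
  set I := Finset.range (s.card + 1)
  set M := ∑ i ∈ s, p i
  set D := Real.pi / (4 * bernoulliVar p' s') with hD
  have hD0 : 0 < D := by positivity
  have hw0 : ∀ m, 0 ≤ w m := coeff_bernoulliGF_nonneg hp
  have hw1 : ∑ m ∈ I, w m = 1 := sum_coeff_bernoulliGF p s
  -- The interpolated value of `r` at the mean `M` serves as centre. It may differ from `rbar`, but
  -- the second moment about the mean `rbar` is the smallest.
  set c := (fourierAt (bernoulliGF p' s') (n - M)).re / (2 * Real.pi) with hc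
  have hlip : ∀ m : ℕ, |r m - c| ≤ D * |m - M| := by
    intro m
    have h1 := norm_fourierAt_sub_le hp' hV ((n : ℝ) - m) (n - M)
    have h2 := (Complex.abs_re_le_norm _).trans h1
    rw [fourierAt_int, ← hr, Complex.sub_re] at h2
    have h3 : ((2 * (Real.pi : ℂ) * (r m : ℂ))).re = 2 * Real.pi * r m := by
      rw [← Complex.ofReal_ofNat, ← Complex.ofReal_mul, ← Complex.ofReal_mul, Complex.ofReal_re]
    rw [h3] at h2
    have h4 : r m - c =
        (2 * Real.pi * r m - (fourierAt (bernoulliGF p' s') (n - M)).re) / (2 * Real.pi) := by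
      rw [hc]; field_simp
    rw [h4, abs_div, abs_of_pos (by positivity : 0 < 2 * Real.pi), div_le_iff₀ (by positivity)]
    refine h2.trans (le_of_eq ?_)
    have h5 : |(n : ℝ) - m - (n - M)| = |(m : ℝ) - M| := by
      rw [← abs_neg]; congr 1; ring
    rw [h5, hD]
    field_simp
    ring
  have hvar : ∑ m ∈ I, w m * |r m - rbar| ^ 2 ≤ D ^ 2 * bernoulliVar p s := by
    have h1 : ∑ m ∈ I, w m * |r m - rbar| ^ 2 =
        ∑ m ∈ I, w m * (r m - c) ^ 2 - (rbar - c) ^ 2 := by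
      have : ∀ m, w m * |r m - rbar| ^ 2 = w m * (r m - c) ^ 2 -
          2 * (rbar - c) * (w m * r m) + (rbar ^ 2 - c ^ 2) * w m := by
        intro m; rw [sq_abs]; ring
      simp_rw [this]
      rw [Finset.sum_add_distrib, Finset.sum_sub_distrib, ← Finset.mul_sum, ← Finset.mul_sum,
        hrbar, hw1]
      ring
    rw [h1, ← sum_coeff_mul_sq_bernoulliGF p s, Finset.mul_sum]
    refine (sub_le_self _ (sq_nonneg _)).trans (Finset.sum_le_sum fun m _ => ?_)
    have h2 : (r m - c) ^ 2 ≤ D ^ 2 * ((m : ℝ) - M) ^ 2 := by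
      rw [← mul_pow, sq_le_sq, abs_mul, abs_of_pos hD0]
      exact hlip m
    calc w m * (r m - c) ^ 2 ≤ w m * (D ^ 2 * ((m : ℝ) - M) ^ 2) :=
          mul_le_mul_of_nonneg_left h2 (hw0 m)
      _ = _ := by ring
  have hcs : (∑ m ∈ I, w m * |r m - rbar|) ^ 2 ≤ ∑ m ∈ I, w m * |r m - rbar| ^ 2 :=
    Real.pow_arith_mean_le_arith_mean_pow I w (fun m => |r m - rbar|) (fun m _ => hw0 m) hw1
      (fun m _ => abs_nonneg _) 2
  refine (sq_le_sq₀ (Finset.sum_nonneg fun m _ => mul_nonneg (hw0 m) (abs_nonneg _))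
    (by positivity)).1 ?_
  have hV0 : 0 ≤ bernoulliVar p s := Finset.sum_nonneg fun i hi =>
    mul_nonneg (hp i hi).1 (by linarith [(hp i hi).2])
  rw [mul_pow, Real.sq_sqrt hV0]
  exact hcs.trans hvar

/-! ### Extremal Bernoulli sums with a given mean -/

/-- The parameter vectors in `[0,1]^ι` with sum `t`. -/
def meanSlice (ι : Type*) [Fintype ι] (t : ℝ) : Set (ι → ℝ) :=
  {p | (∀ i, p i ∈ Set.Icc (0 : ℝ) 1) ∧ ∑ i, p i = t}

theorem isCompact_meanSlice (ι : Type*) [Fintype ι] (t : ℝ) : IsCompact (meanSlice ι t) := by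
  have h1 : IsCompact (Set.univ.pi fun _ : ι => Set.Icc (0 : ℝ) 1) :=
    isCompact_univ_pi fun _ => isCompact_Icc
  have h2 : IsClosed {p : ι → ℝ | ∑ i, p i = t} :=
    isClosed_eq (by fun_prop) continuous_const
  convert! h1.inter_right h2 using 1
  ext p
  simp only [meanSlice, Set.mem_ofPred_eq, Set.mem_inter_iff, Set.mem_univ_pi]

/-- Move the amount `δ` from the coordinate `j` to the coordinate `i`. -/
def transfer {ι : Type*} [DecidableEq ι] (p : ι → ℝ) (i j : ι) (δ : ℝ) : ι → ℝ :=
  Function.update (Function.update p i (p i + δ)) j (p j - δ)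

theorem transfer_left {ι : Type*} [DecidableEq ι] (p : ι → ℝ) {i j : ι} (hij : i ≠ j) (δ : ℝ) :
    transfer p i j δ i = p i + δ := by
  simp [transfer, Function.update_of_ne hij]

theorem transfer_right {ι : Type*} [DecidableEq ι] (p : ι → ℝ) (i j : ι) (δ : ℝ) :
    transfer p i j δ j = p j - δ := by
  simp [transfer]

theorem transfer_of_ne {ι : Type*} [DecidableEq ι] (p : ι → ℝ) {i j k : ι} (hi : k ≠ i)
    (hj : k ≠ j) (δ : ℝ) : transfer p i j δ k = p k := by
  simp [transfer, Function.update_of_ne hi, Function.update_of_ne hj]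

theorem sum_eq_add_add_sum_erase {ι : Type*} [Fintype ι] [DecidableEq ι] (f : ι → ℝ) {i j : ι}
    (hij : i ≠ j) : ∑ k, f k = f i + f j + ∑ k ∈ (Finset.univ.erase i).erase j, f k := by
  rw [← Finset.add_sum_erase _ f (Finset.mem_univ i),
    ← Finset.add_sum_erase _ f (Finset.mem_erase.2 ⟨hij.symm, Finset.mem_univ j⟩), add_assoc]

/-- The function `g` is free: the identity controls the mean, the square the tie-break between
minimizers, and `x(1-x)` the variance. -/
theorem sum_transfer {ι : Type*} [Fintype ι] [DecidableEq ι] (g : ℝ → ℝ) (p : ι → ℝ) {i j : ι}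
    (hij : i ≠ j) (δ : ℝ) :
    ∑ k, g (transfer p i j δ k) =
      ∑ k, g (p k) + (g (p i + δ) + g (p j - δ) - g (p i) - g (p j)) := by
  rw [sum_eq_add_add_sum_erase _ hij, sum_eq_add_add_sum_erase (fun k => g (p k)) hij,
    transfer_left p hij, transfer_right]
  have : ∑ k ∈ (Finset.univ.erase i).erase j, g (transfer p i j δ k) =
      ∑ k ∈ (Finset.univ.erase i).erase j, g (p k) := by
    refine Finset.sum_congr rfl fun k hk => ?_
    simp only [Finset.mem_erase] at hk
    rw [transfer_of_ne p hk.2.1 hk.1]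
  rw [this]
  ring

theorem transfer_mem_meanSlice {ι : Type*} [Fintype ι] [DecidableEq ι] {t : ℝ} {p : ι → ℝ}
    (hp : p ∈ meanSlice ι t) {i j : ι} (hij : i ≠ j) {δ : ℝ}
    (hi : p i + δ ∈ Set.Icc (0 : ℝ) 1) (hj : p j - δ ∈ Set.Icc (0 : ℝ) 1) :
    transfer p i j δ ∈ meanSlice ι t := by
  refine ⟨fun k => ?_, ?_⟩
  · by_cases hki : k = i
    · rw [hki, transfer_left p hij]; exact hi
    · by_cases hkj : k = j
      · rw [hkj, transfer_right]; exact hj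
      · rw [transfer_of_ne p hki hkj]; exact hp.1 k
  · have := sum_transfer (fun x => x) p hij δ
    rw [this, hp.2]
    ring

/-- A continuous function on a mean slice that depends on each pair of coordinates, at fixed sum,
affinely through their product has a minimizer all of whose interior coordinates agree. -/
theorem exists_minimizer_interior_eq {ι : Type*} [Fintype ι] [DecidableEq ι] {t : ℝ}
    (hne : (meanSlice ι t).Nonempty) {F : (ι → ℝ) → ℝ} (hF : Continuous F)
    (hpair : ∀ p : ι → ℝ, ∀ i j, i ≠ j → ∃ κ : ℝ, ∀ δ : ℝ,
      F (transfer p i j δ) = F p + κ * ((p i + δ) * (p j - δ) - p i * p j)) :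
    ∃ p ∈ meanSlice ι t, (∀ p' ∈ meanSlice ι t, F p ≤ F p') ∧
      ∀ i j, p i ∈ Set.Ioo (0 : ℝ) 1 → p j ∈ Set.Ioo (0 : ℝ) 1 → p i = p j := by
  -- Among the minimizers of `F`, one with the least sum of squares is chosen.
  obtain ⟨p₀, hp₀, hmin₀⟩ := (isCompact_meanSlice ι t).exists_isMinOn hne hF.continuousOn
  have hK : IsCompact (meanSlice ι t ∩ {p | F p = F p₀}) :=
    (isCompact_meanSlice ι t).inter_right (isClosed_eq hF continuous_const)
  obtain ⟨p, ⟨hp, hpF⟩, hmin⟩ := hK.exists_isMinOn ⟨p₀, hp₀, rfl⟩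
    (f := fun p : ι → ℝ => ∑ k, p k ^ 2) (by fun_prop)
  have hpF : F p = F p₀ := hpF
  have hminF : ∀ p' ∈ meanSlice ι t, F p ≤ F p' := fun p' hp' => hpF.le.trans (hmin₀ hp')
  refine ⟨p, hp, hminF, fun i j hi hj => ?_⟩
  by_contra hne
  have hij : i ≠ j := fun h => hne (by rw [h])
  have hd : 0 < (p j - p i) ^ 2 := by
    have : p j - p i ≠ 0 := sub_ne_zero.2 (Ne.symm hne)
    positivity
  obtain ⟨κ, hκ⟩ := hpair p i j hij
  have hmid : transfer p i j ((p j - p i) / 2) ∈ meanSlice ι t := by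
    refine transfer_mem_meanSlice hp hij ⟨?_, ?_⟩ ⟨?_, ?_⟩ <;>
      linarith [hi.1, hi.2, hj.1, hj.2]
  have hFmid := hκ ((p j - p i) / 2)
  have hprod : (p i + (p j - p i) / 2) * (p j - (p j - p i) / 2) - p i * p j =
      (p j - p i) ^ 2 / 4 := by ring
  rw [hprod] at hFmid
  -- Averaging two unequal coordinates raises their product: for `κ < 0` this lowers `F`, for `κ =
  -- 0` it keeps `F` and lowers the sum of squares. For `κ > 0`, spreading them apart lowers `F`;
  -- the amount `η` keeps both in `[0,1]`.
  rcases lt_trichotomy κ 0 with h | h | h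
  · have := hminF _ hmid
    nlinarith
  · have h1 : F (transfer p i j ((p j - p i) / 2)) = F p₀ := by rw [hFmid, h, hpF]; ring
    have h2 : ∑ k, p k ^ 2 ≤ ∑ k, transfer p i j ((p j - p i) / 2) k ^ 2 := hmin ⟨hmid, h1⟩
    rw [sum_transfer (fun x => x ^ 2) p hij] at h2
    nlinarith
  · set η := min (min (p i) (1 - p i)) (min (p j) (1 - p j)) with hη
    have hη0 : 0 < η := by
      simp only [hη, lt_min_iff]
      exact ⟨⟨hi.1, by linarith [hi.2]⟩, hj.1, by linarith [hj.2]⟩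
    have e1 : η ≤ p i := (min_le_left _ _).trans (min_le_left _ _)
    have e2 : η ≤ 1 - p i := (min_le_left _ _).trans (min_le_right _ _)
    have e3 : η ≤ p j := (min_le_right _ _).trans (min_le_left _ _)
    have e4 : η ≤ 1 - p j := (min_le_right _ _).trans (min_le_right _ _)
    rcases lt_or_gt_of_ne hne with hlt | hlt
    · have hm := hminF _ (transfer_mem_meanSlice hp hij (δ := -η)
        ⟨by linarith, by linarith⟩ ⟨by linarith, by linarith⟩)
      rw [hκ] at hm
      have : (p i + -η) * (p j - -η) - p i * p j < 0 := by nlinarith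
      nlinarith
    · have hm := hminF _ (transfer_mem_meanSlice hp hij (δ := η)
        ⟨by linarith, by linarith⟩ ⟨by linarith, by linarith⟩)
      rw [hκ] at hm
      have : (p i + η) * (p j - η) - p i * p j < 0 := by nlinarith
      nlinarith

theorem continuous_coeff_bernoulliGF {ι : Type*} (s : Finset ι) (n : ℕ) :
    Continuous fun p : ι → ℝ => (bernoulliGF p s).coeff n := by
  classical
  induction s using Finset.induction_on generalizing n with
  | empty => simp only [bernoulliGF, Finset.prod_empty]; exact continuous_const
  | insert i s hi ih =>
    simp only [bernoulliGF, Finset.prod_insert hi, coeff_mul]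
    refine continuous_finsetSum _ fun x _ => Continuous.mul ?_ (ih x.2)
    simp only [coeff_add, coeff_C_mul, coeff_C]
    split_ifs <;> fun_prop

/-- Two linear factors multiply to `1 + (r i + r j)(X - 1) + r i r j (X - 1)²`, and a transfer fixes
the sum, so only the last term changes. -/
theorem exists_coeff_bernoulliGF_transfer {ι : Type*} [Fintype ι] [DecidableEq ι] (n : ℕ)
    (p : ι → ℝ) {i j : ι} (hij : i ≠ j) : ∃ κ : ℝ, ∀ δ : ℝ,
      (bernoulliGF (transfer p i j δ) Finset.univ).coeff n =
        (bernoulliGF p Finset.univ).coeff n + κ * ((p i + δ) * (p j - δ) - p i * p j) := by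
  have hsplit : ∀ r : ι → ℝ, bernoulliGF r Finset.univ =
      (1 + C (r i + r j) * (X - 1) + C (r i * r j) * (X - 1) ^ 2) *
        bernoulliGF r ((Finset.univ.erase i).erase j) := by
    intro r
    rw [bernoulliGF, ← Finset.mul_prod_erase _ _ (Finset.mem_univ i),
      ← Finset.mul_prod_erase _ _ (Finset.mem_erase.2 ⟨hij.symm, Finset.mem_univ j⟩),
      ← mul_assoc, bernoulliGF]
    congr 1
    simp only [C_sub, C_add, C_mul, C_1]
    ring
  refine ⟨((X - 1) ^ 2 * bernoulliGF p ((Finset.univ.erase i).erase j)).coeff n, fun δ => ?_⟩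
  have hrest : bernoulliGF (transfer p i j δ) ((Finset.univ.erase i).erase j) =
      bernoulliGF p ((Finset.univ.erase i).erase j) := by
    refine Finset.prod_congr rfl fun k hk => ?_
    simp only [Finset.mem_erase] at hk
    rw [transfer_of_ne p hk.2.1 hk.1]
  rw [hsplit, hsplit p, hrest, transfer_left p hij, transfer_right, mul_comm (coeff _ n),
    ← coeff_C_mul, ← coeff_add]
  congr 1
  simp only [C_sub, C_add, C_mul]
  ring

/-! ### The probability of the mean of a binomial variable -/

/-- The Stirling sequence decreases from its first value `e / √2`. -/
theorem factorial_le_exp_mul_sqrt {n : ℕ} (hn : n ≠ 0) :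
    (n.factorial : ℝ) ≤ Real.exp 1 * √n * (n / Real.exp 1) ^ n := by
  obtain ⟨k, rfl⟩ := Nat.exists_eq_succ_of_ne_zero hn
  have h := Stirling.stirlingSeq'_antitone (Nat.zero_le k)
  simp only [Function.comp_apply, Nat.succ_eq_add_one, zero_add, Stirling.stirlingSeq_one] at h
  rw [Stirling.stirlingSeq, div_le_iff₀ (by positivity)] at h
  refine h.trans (le_of_eq ?_)
  rw [Real.sqrt_mul (by norm_num)]
  push_cast
  field_simp

/-- The constant `√(2π)/e²` in the lower bound for the central probability. -/
def centralConst : ℝ := √(2 * Real.pi) / Real.exp 1 ^ 2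

theorem centralConst_pos : 0 < centralConst := by
  have := Real.pi_pos
  unfold centralConst
  positivity

/-- Stirling from below for `(m+k)!` and from above for `m!` and `k!`; the powers cancel. The
quantity `mk/(m+k)` is the variance of the binomial law with `m + k` trials and mean `m`. -/
theorem centralConst_div_sqrt_le_binomial {m k : ℕ} (hm : m ≠ 0) (hk : k ≠ 0) :
    centralConst / √((m : ℝ) * k / (m + k)) ≤
      ((m + k).choose m : ℝ) * ((m : ℝ) / (m + k)) ^ m * ((k : ℝ) / (m + k)) ^ k := by
  have hm0 : (0 : ℝ) < m := by positivity
  have hk0 : (0 : ℝ) < k := by positivity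
  have hpi := Real.pi_pos
  have h1 := Stirling.le_factorial_stirling (m + k)
  have h2 := factorial_le_exp_mul_sqrt hm
  have h3 := factorial_le_exp_mul_sqrt hk
  have hch : ((m + k).choose m : ℝ) =
      ((m + k).factorial : ℝ) / ((m.factorial : ℝ) * k.factorial) := by
    rw [Nat.choose_symm_add, Nat.add_choose, Nat.cast_div (Nat.factorial_mul_factorial_dvd_factorial_add m k)
      (by positivity)]
    push_cast; rfl
  have h4 : √(2 * Real.pi * ((m + k : ℕ) : ℝ)) * (((m + k : ℕ) : ℝ) / Real.exp 1) ^ (m + k) /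
      ((Real.exp 1 * √m * (m / Real.exp 1) ^ m) * (Real.exp 1 * √k * (k / Real.exp 1) ^ k)) ≤
      ((m + k).choose m : ℝ) := by
    rw [hch]
    gcongr
  have h5 := mul_le_mul_of_nonneg_right h4
    (by positivity : 0 ≤ ((m : ℝ) / (m + k)) ^ m * ((k : ℝ) / (m + k)) ^ k)
  refine le_trans (le_of_eq ?_) (h5.trans (le_of_eq (by ring)))
  rw [centralConst, Real.sqrt_div (by positivity), Real.sqrt_mul hm0.le,
    Real.sqrt_mul (by positivity : 0 ≤ 2 * Real.pi)]
  push_cast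
  simp only [div_pow, pow_add]
  field_simp

/-- The convex function `W ↦ 1/√W` lies above its tangent at `V`. This makes the lower bound affine
in the variance, as the extremal argument requires. -/
theorem tangent_inv_sqrt {V W : ℝ} (hV : 0 < V) (hW : 0 < W) :
    3 / 2 / √V ≤ 1 / √W + W / (2 * V * √V) := by
  obtain ⟨v, hv, rfl⟩ : ∃ v, 0 < v ∧ V = v ^ 2 :=
    ⟨√V, Real.sqrt_pos.2 hV, (Real.sq_sqrt hV.le).symm⟩
  obtain ⟨w, hw, rfl⟩ : ∃ w, 0 < w ∧ W = w ^ 2 :=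
    ⟨√W, Real.sqrt_pos.2 hW, (Real.sq_sqrt hW.le).symm⟩
  rw [Real.sqrt_sq hv.le, Real.sqrt_sq hw.le, ← sub_nonneg]
  have : 1 / w + w ^ 2 / (2 * v ^ 2 * v) - 3 / 2 / v =
      (v - w) ^ 2 * (2 * v + w) / (2 * v ^ 3 * w) := by
    field_simp
    ring
  rw [this]
  positivity

/-- Serves the degenerate case of a deterministic sum, where the central probability is `1` and `V ≥
1/2`. -/
theorem centralConst_le : 3 / 2 * centralConst ≤ √(1 / 2) := by
  have h1 : (2.7 : ℝ) < Real.exp 1 := by linarith [Real.exp_one_gt_d9]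
  have h2 := Real.pi_lt_d2
  unfold centralConst
  have h3 : √(2 * Real.pi) ≤ 2.52 :=
    Real.sqrt_le_iff.2 ⟨by norm_num, by norm_num at h2 ⊢; linarith⟩
  have h4 : (0.7 : ℝ) ≤ √(1 / 2) := Real.le_sqrt_of_sq_le (by norm_num)
  have h5 : √(2 * Real.pi) / Real.exp 1 ^ 2 ≤ 2.52 / 2.7 ^ 2 := by gcongr
  refine le_trans (mul_le_mul_of_nonneg_left h5 (by norm_num)) (le_trans ?_ h4)
  norm_num

theorem coeff_linear_pow (a b : ℝ) {N m : ℕ} (hm : m ≤ N) :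
    ((C a + C b * X) ^ N : ℝ[X]).coeff m = N.choose m * b ^ m * a ^ (N - m) := by
  rw [add_comm, add_pow, finsetSum_coeff, Finset.sum_eq_single m]
  · rw [mul_pow, ← C_pow, ← C_pow, mul_assoc, mul_assoc, coeff_C_mul, mul_comm (X ^ m),
      ← C_eq_natCast, ← C_mul, coeff_C_mul_X_pow, if_pos rfl]
    ring
  · intro k _ hk
    rw [mul_pow, ← C_pow, ← C_pow, mul_assoc, mul_assoc, coeff_C_mul, mul_comm (X ^ k),
      ← C_eq_natCast, ← C_mul, coeff_C_mul_X_pow, if_neg hk.symm, mul_zero]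
  · intro h
    exact absurd (Finset.mem_range.2 (by omega)) h

/-- The lower bound for parameters that only take the values `0`, `1` and one further value. -/
theorem tangent_le_of_interior_eq {ι : Type*} [Fintype ι] {p : ι → ℝ} {n : ℕ}
    (hp : p ∈ meanSlice ι n)
    (heq : ∀ i j, p i ∈ Set.Ioo (0 : ℝ) 1 → p j ∈ Set.Ioo (0 : ℝ) 1 → p i = p j)
    {V : ℝ} (hV : 1 / 2 ≤ V) :
    3 / 2 * centralConst / √V ≤ (bernoulliGF p Finset.univ).coeff n +
      centralConst / (2 * V * √V) * bernoulliVar p Finset.univ := by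
  classical
  have hc := centralConst_pos
  have hV0 : 0 < V := by linarith
  obtain ⟨x, hx, hx'⟩ : ∃ x, x ∈ Set.Ioo (0 : ℝ) 1 ∧ ∀ i, p i ∈ Set.Ioo (0 : ℝ) 1 → p i = x := by
    by_cases h : ∃ i, p i ∈ Set.Ioo (0 : ℝ) 1
    · obtain ⟨i, hi⟩ := h
      exact ⟨p i, hi, fun j hj => heq j i hj hi⟩
    -- Without interior coordinates any value in `(0,1)` will do; `T` is then empty.
    · exact ⟨1 / 2, by norm_num, fun i hi => absurd ⟨i, hi⟩ h⟩
  set T := Finset.univ.filter fun i => p i = x with hT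
  set O := Finset.univ.filter fun i => p i = 1 with hO
  have hcases : ∀ i, p i = 0 ∨ p i = 1 ∨ p i = x := by
    intro i
    rcases eq_or_lt_of_le (hp.1 i).1 with h | h
    · exact Or.inl h.symm
    · rcases eq_or_lt_of_le (hp.1 i).2 with h' | h'
      · exact Or.inr (Or.inl h')
      · exact Or.inr (Or.inr (hx' i ⟨h, h'⟩))
  have h0x : (0 : ℝ) ≠ x := hx.1.ne
  have h1x : (1 : ℝ) ≠ x := hx.2.ne'
  have hsum : ∀ g : ℝ → ℝ, g 0 = 0 → ∑ i, g (p i) = O.card * g 1 + T.card * g x := by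
    intro g hg
    have : ∀ i, g (p i) = (if p i = 1 then g 1 else 0) + (if p i = x then g x else 0) := by
      intro i
      rcases hcases i with h | h | h
      · simp [h, h0x, hg]
      · simp [h, h1x]
      · simp [h, h1x.symm]
    simp_rw [this]
    rw [Finset.sum_add_distrib, ← Finset.sum_filter, ← Finset.sum_filter, Finset.sum_const,
      Finset.sum_const, nsmul_eq_mul, nsmul_eq_mul]
  have hGF : bernoulliGF p Finset.univ = X ^ O.card * (C (1 - x) + C x * X) ^ T.card := by
    have : ∀ i, C (1 - p i) + C (p i) * X =
        (if p i = 1 then (X : ℝ[X]) else 1) * (if p i = x then (C (1 - x) + C x * X) else 1) := by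
      intro i
      rcases hcases i with h | h | h
      · simp [h, h0x]
      · simp [h, h1x]
      · simp [h, h1x.symm]
    rw [bernoulliGF]
    simp_rw [this]
    rw [Finset.prod_mul_distrib, ← Finset.prod_filter, ← Finset.prod_filter, Finset.prod_const,
      Finset.prod_const]
  have hmean : (O.card : ℝ) + T.card * x = n := by
    rw [← hp.2, hsum (fun y => y) rfl, mul_one]
  have hvar : bernoulliVar p Finset.univ = T.card * (x * (1 - x)) := by
    rw [bernoulliVar, hsum (fun y => y * (1 - y)) (by simp)]
    simp
  have hOn : O.card ≤ n := by
    have : (O.card : ℝ) ≤ n := by rw [← hmean]; nlinarith [hx.1, (T.card.cast_nonneg : (0:ℝ) ≤ _)]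
    exact_mod_cast this
  obtain ⟨m, rfl⟩ := Nat.exists_eq_add_of_le hOn
  -- Removing the sure successes leaves a binomial law whose mean is again an integer.
  have hm : (T.card : ℝ) * x = m := by push_cast at hmean; linarith
  have hcoeff : (bernoulliGF p Finset.univ).coeff (O.card + m) =
      ((C (1 - x) + C x * X) ^ T.card : ℝ[X]).coeff m := by
    rw [hGF, add_comm O.card m, coeff_X_pow_mul]
  rw [hcoeff, hvar]
  rcases Nat.eq_zero_or_pos T.card with h0 | h0
  · have hm0 : m = 0 := by rw [h0] at hm; simpa using hm.symm
    rw [h0, hm0]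
    simp only [pow_zero, coeff_one_zero, Nat.cast_zero, zero_mul, mul_zero, add_zero]
    rw [div_le_one (by positivity)]
    exact centralConst_le.trans (Real.sqrt_le_sqrt hV)
  · have hT0 : (0 : ℝ) < T.card := by exact_mod_cast h0
    have hmpos : 0 < m := by
      have : (0 : ℝ) < m := by rw [← hm]; exact mul_pos hT0 hx.1
      exact_mod_cast this
    have hmlt : m < T.card := by
      have : (m : ℝ) < T.card := by rw [← hm]; nlinarith [hx.2]
      exact_mod_cast this
    obtain ⟨k, hk⟩ := Nat.exists_eq_add_of_le hmlt.le
    have hk0 : k ≠ 0 := by omega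
    rw [coeff_linear_pow _ _ hmlt.le, hk, Nat.add_sub_cancel_left]
    rw [hk] at hm
    push_cast at hm ⊢
    have hk0' : (0 : ℝ) < k := by positivity
    have hm0' : (0 : ℝ) < m := by positivity
    have hxm : x = (m : ℝ) / (m + k) := by field_simp; linarith
    have hxk : 1 - x = (k : ℝ) / (m + k) := by rw [hxm]; field_simp; ring
    rw [hxk, hxm]
    have h1 := centralConst_div_sqrt_le_binomial hmpos.ne' hk0
    have h2 := mul_le_mul_of_nonneg_left (tangent_inv_sqrt hV0
      (by positivity : (0 : ℝ) < (m : ℝ) * k / (m + k))) hc.le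
    have h3 : ((m : ℝ) + k) * ((m : ℝ) / (m + k) * (k / (m + k))) = (m : ℝ) * k / (m + k) := by
      field_simp
    rw [h3]
    calc 3 / 2 * centralConst / √V = centralConst * (3 / 2 / √V) := by ring
      _ ≤ _ := h2
      _ = centralConst / √((m : ℝ) * k / (m + k)) +
          centralConst / (2 * V * √V) * ((m : ℝ) * k / (m + k)) := by ring
      _ ≤ _ := by gcongr

/-- A Bernoulli sum whose mean is an integer `n` takes the value `n` with probability at least a
constant times the inverse standard deviation. -/
theorem centralConst_div_sqrt_le_coeff {ι : Type*} {p : ι → ℝ} {s : Finset ι}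
    (hp : ∀ i ∈ s, 0 ≤ p i ∧ p i ≤ 1) {n : ℕ} (hn : ∑ i ∈ s, p i = n)
    (hV : 1 / 2 ≤ bernoulliVar p s) :
    centralConst / √(bernoulliVar p s) ≤ (bernoulliGF p s).coeff n := by
  classical
  set V := bernoulliVar p s with hVdef
  have hV0 : 0 < V := by linarith
  -- Minus the slope at `V` of the tangent to `W ↦ centralConst / √W`.
  set lam := centralConst / (2 * V * √V) with hlam
  set p' : s → ℝ := fun i => p i with hp'
  have hmem : p' ∈ meanSlice s n :=
    ⟨fun i => hp i i.2, by rw [← hn]; exact Finset.sum_coe_sort s p⟩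
  have hGF : bernoulliGF p' Finset.univ = bernoulliGF p s :=
    Finset.prod_coe_sort s fun i => C (1 - p i) + C (p i) * X
  have hvar : bernoulliVar p' Finset.univ = V :=
    Finset.sum_coe_sort s fun i => p i * (1 - p i)
  obtain ⟨r, hr, hmin, heq⟩ := exists_minimizer_interior_eq ⟨p', hmem⟩
    (F := fun r : s → ℝ => (bernoulliGF r Finset.univ).coeff n + lam * bernoulliVar r Finset.univ)
    (by
      have h1 := continuous_coeff_bernoulliGF (Finset.univ : Finset s) n
      have h2 : Continuous fun r : s → ℝ => bernoulliVar r Finset.univ := by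
        unfold bernoulliVar; fun_prop
      fun_prop)
    (fun r i j hij => by
      obtain ⟨κ, hκ⟩ := exists_coeff_bernoulliGF_transfer n r hij
      -- At fixed sum, the variance changes by twice the change of the product.
      refine ⟨κ + 2 * lam, fun δ => ?_⟩
      have := sum_transfer (fun x => x * (1 - x)) r hij δ
      simp only [bernoulliVar]
      rw [hκ, this]
      ring)
  have h1 := hmin p' hmem
  have h2 := tangent_le_of_interior_eq hr heq hV
  simp only [hGF, hvar] at h1
  have h3 : lam * V = 1 / 2 * centralConst / √V := by
    rw [hlam]; field_simp
  have h4 : centralConst / √V = 3 / 2 * centralConst / √V - 1 / 2 * centralConst / √V := by ring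
  linarith

open Matrix

/-! ### Product states and their particle number sectors -/

/-- The normalized product state with occupation probabilities `p x`. -/
def productAmp (p : Site → ℝ) {Λ : Finset Site} (α : Config Λ) : ℝ :=
  ∏ x : ↥Λ, if α x = 1 then √(p x) else √(1 - p x)

/-- The component with `n` particles of the product state. -/
def sectorState (p : Site → ℝ) (Λ : Finset Site) (n : ℕ) : StateVec Λ :=
  fun α => if numParticles α = n then (productAmp p α : ℂ) else 0

/-- The unnormalized expectation of `X` in the `n` particle component of the product state. -/
def sectorNum (p : Site → ℝ) {Λ : Finset Site} (n : ℕ) (X : Observable Λ) : ℂ :=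
  star (sectorState p Λ n) ⬝ᵥ (X *ᵥ sectorState p Λ n)

theorem expectation_smul {Λ : Finset Site} {c : ℂ} (hc : c ≠ 0) (ψ : StateVec Λ)
    (X : Observable Λ) : expectation (c • ψ) X = expectation ψ X := by
  simp only [expectation, star_smul, mulVec_smul, smul_dotProduct, dotProduct_smul, smul_eq_mul]
  rw [mul_div_mul_left _ _ hc, mul_div_mul_left _ _ (star_ne_zero.2 hc)]

theorem sectorNum_eq_sum (p : Site → ℝ) {Λ : Finset Site} (n : ℕ) (X : Observable Λ) :
    sectorNum p n X = ∑ α, ∑ β, if numParticles α = n ∧ numParticles β = n then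
      ((productAmp p α * productAmp p β : ℝ) : ℂ) * X α β else 0 := by
  simp only [sectorNum, dotProduct, mulVec, Finset.mul_sum]
  refine Finset.sum_congr rfl fun α _ => Finset.sum_congr rfl fun β _ => ?_
  by_cases h1 : numParticles α = n <;> by_cases h2 : numParticles β = n <;>
    simp [sectorState, h1, h2]
  ring

theorem coe_fin_two_eq_ite (a : Fin 2) : (a : ℕ) = if a = 1 then 1 else 0 := by
  fin_cases a <;> simp

theorem numParticles_le_card {Λ : Finset Site} (α : Config Λ) : numParticles α ≤ Λ.card := by
  unfold numParticles
  calc ∑ x, (α x : ℕ) ≤ ∑ _x : ↥Λ, 1 := Finset.sum_le_sum fun x _ => by omega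
    _ = Λ.card := by simp

/-- Expanding the product of the linear factors gives one term per configuration, its weight times
`X` to its particle number. -/
theorem sum_productAmp_sq {p : Site → ℝ} (hp : ∀ x, 0 < p x ∧ p x < 1) (Λ : Finset Site)
    (k : ℕ) : ∑ α : Config Λ, (if numParticles α = k then productAmp p α ^ 2 else 0) =
      (bernoulliGF p Λ).coeff k := by
  have h : bernoulliGF p Λ =
      ∑ α : Config Λ, C (productAmp p α ^ 2) * X ^ numParticles α := by
    rw [bernoulliGF, ← Finset.prod_coe_sort]
    have h1 : ∀ x : ↥Λ, C (1 - p x) + C (p x) * X =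
        ∑ a : Fin 2, C ((if a = 1 then √(p x) else √(1 - p x)) ^ 2) * (X : ℝ[X]) ^ (a : ℕ) := by
      intro x
      rw [Fin.sum_univ_two]
      simp [Real.sq_sqrt (hp x).1.le, Real.sq_sqrt (sub_nonneg.2 (hp x).2.le)]
    simp_rw [h1]
    rw [Fintype.prod_sum]
    refine Finset.sum_congr rfl fun α _ => ?_
    rw [Finset.prod_mul_distrib, Finset.prod_pow_eq_pow_sum, numParticles, productAmp,
      ← Finset.prod_pow, map_prod]
  rw [h, finsetSum_coeff]
  refine Finset.sum_congr rfl fun α _ => ?_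
  rw [coeff_C_mul_X_pow]
  simp only [eq_comm]

theorem star_sectorState_dotProduct {p : Site → ℝ} (hp : ∀ x, 0 < p x ∧ p x < 1)
    (Λ : Finset Site) (n : ℕ) :
    star (sectorState p Λ n) ⬝ᵥ sectorState p Λ n = (((bernoulliGF p Λ).coeff n : ℝ) : ℂ) := by
  rw [← sum_productAmp_sq hp, Complex.ofReal_sum]
  refine Finset.sum_congr rfl fun α _ => ?_
  by_cases h : numParticles α = n <;> simp [sectorState, h]
  ring

theorem expectation_sectorState {p : Site → ℝ} (hp : ∀ x, 0 < p x ∧ p x < 1)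
    {Λ : Finset Site} (n : ℕ) (X : Observable Λ) :
    expectation (sectorState p Λ n) X =
      sectorNum p n X / (((bernoulliGF p Λ).coeff n : ℝ) : ℂ) := by
  rw [expectation, star_sectorState_dotProduct hp, sectorNum]

theorem productAmp_pos {p : Site → ℝ} (hp : ∀ x, 0 < p x ∧ p x < 1) {Λ : Finset Site}
    (α : Config Λ) : 0 < productAmp p α := by
  refine Finset.prod_pos fun x _ => ?_
  split_ifs
  · exact Real.sqrt_pos.2 (hp x).1
  · exact Real.sqrt_pos.2 (sub_pos.2 (hp x).2)

theorem exists_numParticles_eq (Λ : Finset Site) {k : ℕ} (hk : k ≤ Λ.card) :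
    ∃ α : Config Λ, numParticles α = k := by
  obtain ⟨s, -, hs⟩ := Finset.exists_subset_card_eq
    (s := (Finset.univ : Finset ↥Λ)) (n := k) (by simpa using hk)
  refine ⟨fun x => if x ∈ s then 1 else 0, ?_⟩
  have h : ∀ x : ↥Λ, ((if x ∈ s then 1 else 0 : Fin 2) : ℕ) = if x ∈ s then 1 else 0 := by
    intro x
    split_ifs <;> rfl
  rw [numParticles]
  simp_rw [h]
  rw [← hs, Finset.sum_boole, Finset.filter_univ_mem, Nat.cast_id]

theorem coeff_bernoulliGF_pos {p : Site → ℝ} (hp : ∀ x, 0 < p x ∧ p x < 1) {Λ : Finset Site}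
    {k : ℕ} (hk : k ≤ Λ.card) : 0 < (bernoulliGF p Λ).coeff k := by
  obtain ⟨α, hα⟩ := exists_numParticles_eq Λ hk
  rw [← sum_productAmp_sq hp]
  refine Finset.sum_pos' (fun β _ => by split_ifs <;> positivity) ⟨α, Finset.mem_univ α, ?_⟩
  rw [if_pos hα]
  have := productAmp_pos hp α
  positivity

/-! ### Observables that conserve the particle number -/

/-- Total spin is `|Λ|/2 - N`, so commuting with it means conserving the particle number. -/
theorem totalSpin3_eq_diagonal (Λ : Finset Site) :
    totalSpin3 Λ = diagonal fun α => (Λ.card : ℂ) / 2 - numParticles α := by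
  ext α β
  rw [totalSpin3, Matrix.sum_apply, diagonal_apply]
  split_ifs with h
  · subst h
    have h1 : ∀ x : ↥Λ, siteOp x spin3 α α = 1 / 2 - ((α x : ℕ) : ℂ) := by
      intro x
      rw [siteOp, of_apply, if_pos fun _ _ => rfl]
      generalize α x = a
      fin_cases a <;> simp [spin3]
      norm_num
    simp_rw [h1]
    rw [Finset.sum_sub_distrib, numParticles]
    push_cast
    simp [div_eq_mul_inv]
  · refine Finset.sum_eq_zero fun x _ => ?_
    rw [siteOp, of_apply]
    split_ifs with h'
    · have hx : α x ≠ β x := fun hx => h (funext fun y => by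
        by_cases hy : y = x
        · rw [hy, hx]
        · exact h' y hy)
      revert hx
      generalize α x = a
      generalize β x = b
      fin_cases a <;> fin_cases b <;> simp [spin3]
    · rfl

theorem apply_eq_zero_of_commute_totalSpin3 {Λ : Finset Site} {X : Observable Λ}
    (hX : Commute X (totalSpin3 Λ)) {α β : Config Λ} (h : numParticles α ≠ numParticles β) :
    X α β = 0 := by
  have h1 := congrFun (congrFun hX.eq α) β
  rw [totalSpin3_eq_diagonal, mul_diagonal, diagonal_mul] at h1
  have h2 : X α β * ((numParticles α : ℂ) - numParticles β) = 0 := by linear_combination h1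
  rcases mul_eq_zero.1 h2 with h3 | h3
  · exact h3
  · exact absurd (by exact_mod_cast sub_eq_zero.1 h3) h

/-- The expectation of a number conserving observable in the normalized product state. -/
theorem expectation_productAmp {p : Site → ℝ} (hp : ∀ x, 0 < p x ∧ p x < 1) {Λ : Finset Site}
    {X : Observable Λ} (hX : ∀ α β, numParticles α ≠ numParticles β → X α β = 0) :
    expectation (fun α => (productAmp p α : ℂ)) X =
      ∑ m ∈ Finset.range (Λ.card + 1), sectorNum p m X := by
  have hden : star (fun α : Config Λ => (productAmp p α : ℂ)) ⬝ᵥ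
      (fun α : Config Λ => (productAmp p α : ℂ)) = 1 := by
    have h1 : ∑ α : Config Λ, productAmp p α ^ 2 = 1 := by
      rw [← sum_coeff_bernoulliGF p Λ]
      simp_rw [← sum_productAmp_sq hp]
      rw [Finset.sum_comm]
      refine Finset.sum_congr rfl fun α _ => ?_
      rw [Finset.sum_ite_eq, if_pos (Finset.mem_range.2
        (Nat.lt_succ_of_le (numParticles_le_card α)))]
    rw [← Complex.ofReal_one, ← h1, Complex.ofReal_sum]
    refine Finset.sum_congr rfl fun α _ => ?_
    simp [sq]
  rw [expectation, hden, div_one]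
  simp_rw [sectorNum_eq_sum]
  rw [Finset.sum_comm, dotProduct]
  refine Finset.sum_congr rfl fun α _ => ?_
  rw [Finset.sum_comm, mulVec, dotProduct, Finset.mul_sum]
  refine Finset.sum_congr rfl fun β _ => ?_
  rw [Finset.sum_eq_single (numParticles α)]
  · by_cases h : numParticles α = numParticles β
    · rw [if_pos ⟨rfl, h.symm⟩]
      simp
      ring
    · rw [hX α β h]
      simp
  · intro m _ hm
    rw [if_neg fun h => hm h.1.symm]
  · intro h
    exact absurd (Finset.mem_range.2 (Nat.lt_succ_of_le (numParticles_le_card α))) h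

/-! ### Splitting off a subvolume -/

/-- A volume is the disjoint union of a subvolume and its complement. -/
def splitSite {Λ₀ Λ : Finset Site} (h : Λ₀ ⊆ Λ) : ↥Λ₀ ⊕ ↥(Λ \ Λ₀) ≃ ↥Λ :=
  Equiv.ofBijective
    (Sum.elim (fun x => ⟨x.1, h x.2⟩) fun x => ⟨x.1, (Finset.mem_sdiff.1 x.2).1⟩) (by
      constructor
      · rintro (⟨x, hx⟩ | ⟨x, hx⟩) (⟨y, hy⟩ | ⟨y, hy⟩) hxy
        · simpa using hxy
        · simp only [Sum.elim_inl, Sum.elim_inr, Subtype.mk.injEq] at hxy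
          exact absurd (hxy ▸ hx) (Finset.mem_sdiff.1 hy).2
        · simp only [Sum.elim_inl, Sum.elim_inr, Subtype.mk.injEq] at hxy
          exact absurd (hxy ▸ hy) (Finset.mem_sdiff.1 hx).2
        · simpa using hxy
      · rintro ⟨x, hx⟩
        by_cases hx₀ : x ∈ Λ₀
        · exact ⟨Sum.inl ⟨x, hx₀⟩, rfl⟩
        · exact ⟨Sum.inr ⟨x, Finset.mem_sdiff.2 ⟨hx, hx₀⟩⟩, rfl⟩)

/-- Configurations of a volume are pairs of configurations of a subvolume and its complement. -/
def splitConfig {Λ₀ Λ : Finset Site} (h : Λ₀ ⊆ Λ) : Config Λ ≃ Config Λ₀ × Config (Λ \ Λ₀) :=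
  ((splitSite h).arrowCongr (Equiv.refl (Fin 2))).symm.trans
    (Equiv.sumArrowEquivProdArrow _ _ _)

theorem restrictConfig_eq_splitConfig_fst {Λ₀ Λ : Finset Site} (h : Λ₀ ⊆ Λ) (α : Config Λ) :
    restrictConfig h α = (splitConfig h α).1 := rfl

theorem numParticles_split {Λ₀ Λ : Finset Site} (h : Λ₀ ⊆ Λ) (α : Config Λ) :
    numParticles α = numParticles (splitConfig h α).1 + numParticles (splitConfig h α).2 := by
  rw [numParticles, ← (splitSite h).sum_comp, Fintype.sum_sum_type]
  rfl

theorem productAmp_split (p : Site → ℝ) {Λ₀ Λ : Finset Site} (h : Λ₀ ⊆ Λ) (α : Config Λ) :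
    productAmp p α = productAmp p (splitConfig h α).1 * productAmp p (splitConfig h α).2 := by
  rw [productAmp, ← (splitSite h).prod_comp, Fintype.prod_sum_type]
  rfl

theorem eq_off_iff_splitConfig_snd_eq {Λ₀ Λ : Finset Site} (h : Λ₀ ⊆ Λ) (α β : Config Λ) :
    (∀ x : ↥Λ, x.1 ∉ Λ₀ → α x = β x) ↔ (splitConfig h α).2 = (splitConfig h β).2 := by
  constructor
  · intro H
    funext x
    exact H _ (Finset.mem_sdiff.1 x.2).2
  · rintro H ⟨x, hx⟩ hx₀
    exact congrFun H ⟨x, Finset.mem_sdiff.2 ⟨hx, hx₀⟩⟩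

/-- The law of the particle number outside of `Λ₀`, seen from inside: the probability of `n - m`
particles in the complement. -/
def outsideProb (p : Site → ℝ) (Λ : Finset Site) (n m : ℕ) : ℝ :=
  if m ≤ n then (bernoulliGF p Λ).coeff (n - m) else 0

theorem sum_productAmp_sq_eq_outsideProb {p : Site → ℝ} (hp : ∀ x, 0 < p x ∧ p x < 1)
    (Λ : Finset Site) (n m : ℕ) :
    ∑ γ : Config Λ, (if m + numParticles γ = n then productAmp p γ ^ 2 else 0) =
      outsideProb p Λ n m := by
  unfold outsideProb
  split_ifs with h
  · rw [← sum_productAmp_sq hp]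
    refine Finset.sum_congr rfl fun γ _ => ?_
    have : m + numParticles γ = n ↔ numParticles γ = n - m := by omega
    simp only [this]
  · exact Finset.sum_eq_zero fun γ _ => if_neg (by omega)

/-- Decomposition of a canonical expectation according to the number of particles in `Λ₀`. -/
theorem sectorNum_ampliation {p : Site → ℝ} (hp : ∀ x, 0 < p x ∧ p x < 1)
    {Λ₀ Λ : Finset Site} (h : Λ₀ ⊆ Λ) {X : Observable Λ₀}
    (hX : ∀ α β, numParticles α ≠ numParticles β → X α β = 0) (n : ℕ) :
    sectorNum p n (ampliation h X) =
      ∑ m ∈ Finset.range (Λ₀.card + 1), (outsideProb p (Λ \ Λ₀) n m : ℂ) * sectorNum p m X := by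
  have hR : ∑ m ∈ Finset.range (Λ₀.card + 1),
      (outsideProb p (Λ \ Λ₀) n m : ℂ) * sectorNum p m X =
      ∑ α : Config Λ₀, ∑ β : Config Λ₀, (outsideProb p (Λ \ Λ₀) n (numParticles α) : ℂ) *
        (((productAmp p α * productAmp p β : ℝ) : ℂ) * X α β) := by
    simp_rw [sectorNum_eq_sum, Finset.mul_sum]
    rw [Finset.sum_comm]
    refine Finset.sum_congr rfl fun α _ => ?_
    rw [Finset.sum_comm]
    refine Finset.sum_congr rfl fun β _ => ?_
    rw [Finset.sum_eq_single (numParticles α)]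
    · by_cases hαβ : numParticles α = numParticles β
      · rw [if_pos ⟨rfl, hαβ.symm⟩]
      · rw [hX α β hαβ]
        simp
    · intro m _ hm
      rw [if_neg fun h => hm h.1.symm, mul_zero]
    · intro h
      exact absurd (Finset.mem_range.2 (Nat.lt_succ_of_le (numParticles_le_card α))) h
  have hL : sectorNum p n (ampliation h X) =
      ∑ a : Config Λ₀ × Config (Λ \ Λ₀), ∑ b : Config Λ₀ × Config (Λ \ Λ₀),
        if numParticles a.1 + numParticles a.2 = n ∧ numParticles b.1 + numParticles b.2 = n then
          ((productAmp p a.1 * productAmp p a.2 * (productAmp p b.1 * productAmp p b.2) : ℝ) : ℂ) *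
            (if a.2 = b.2 then X a.1 b.1 else 0) else 0 := by
    rw [sectorNum_eq_sum, ← (splitConfig h).sum_comp]
    refine Finset.sum_congr rfl fun α _ => ?_
    rw [← (splitConfig h).sum_comp]
    refine Finset.sum_congr rfl fun β _ => ?_
    rw [← numParticles_split, ← numParticles_split, ← productAmp_split, ← productAmp_split,
      ampliation, of_apply, restrictConfig_eq_splitConfig_fst, restrictConfig_eq_splitConfig_fst]
    simp only [eq_off_iff_splitConfig_snd_eq h]
  rw [hL, hR, Fintype.sum_prod_type]
  refine Finset.sum_congr rfl fun α _ => ?_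
  simp_rw [Fintype.sum_prod_type]
  rw [Finset.sum_comm]
  refine Finset.sum_congr rfl fun β _ => ?_
  rw [← sum_productAmp_sq_eq_outsideProb hp, Complex.ofReal_sum, Finset.sum_mul]
  refine Finset.sum_congr rfl fun γ _ => ?_
  -- `X ⊗ 1` forces the two outer configurations to agree, so the outer amplitudes combine to a
  -- probability.
  rw [Finset.sum_eq_single γ]
  · by_cases hαβ : numParticles α = numParticles β
    · rw [← hαβ]
      by_cases hn : numParticles α + numParticles γ = n
      · simp only [hn, and_self, if_true]
        push_cast
        ring
      · simp [hn]
    · rw [hX α β hαβ]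
      simp
  · intro γ' _ hγ
    simp [hγ.symm]
  · intro h
    exact absurd (Finset.mem_univ γ) h

/-- Total probability: the generating functions multiply. Both sums are extended to the range up to
`max Λ₀.card n`, where the added terms vanish. -/
theorem sum_coeff_mul_outsideProb (p : Site → ℝ) {Λ₀ Λ : Finset Site} (h : Λ₀ ⊆ Λ) (n : ℕ) :
    ∑ m ∈ Finset.range (Λ₀.card + 1),
      (bernoulliGF p Λ₀).coeff m * outsideProb p (Λ \ Λ₀) n m = (bernoulliGF p Λ).coeff n := by
  have hGF : bernoulliGF p Λ = bernoulliGF p Λ₀ * bernoulliGF p (Λ \ Λ₀) := by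
    rw [bernoulliGF, bernoulliGF, bernoulliGF, mul_comm, Finset.prod_sdiff h]
  rw [hGF, coeff_mul, Finset.Nat.sum_antidiagonal_eq_sum_range_succ
    (fun i j => (bernoulliGF p Λ₀).coeff i * (bernoulliGF p (Λ \ Λ₀)).coeff j)]
  have h1 : ∀ N, Λ₀.card ≤ N → ∑ m ∈ Finset.range (Λ₀.card + 1),
      (bernoulliGF p Λ₀).coeff m * outsideProb p (Λ \ Λ₀) n m =
      ∑ m ∈ Finset.range (N + 1),
        (bernoulliGF p Λ₀).coeff m * outsideProb p (Λ \ Λ₀) n m := by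
    intro N hN
    refine Finset.sum_subset (Finset.range_subset_range.2 (by omega)) fun m _ hm => ?_
    rw [coeff_eq_zero_of_natDegree_lt, zero_mul]
    refine (natDegree_bernoulliGF_le p Λ₀).trans_lt ?_
    simpa [Nat.lt_succ_iff] using hm
  have h2 : ∑ m ∈ Finset.range (n + 1),
      (bernoulliGF p Λ₀).coeff m * (bernoulliGF p (Λ \ Λ₀)).coeff (n - m) =
      ∑ m ∈ Finset.range (n + 1),
        (bernoulliGF p Λ₀).coeff m * outsideProb p (Λ \ Λ₀) n m := by
    refine Finset.sum_congr rfl fun m hm => ?_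
    rw [outsideProb, if_pos (by rw [Finset.mem_range] at hm; omega)]
  rw [h1 (max Λ₀.card n) (le_max_left _ _), h2]
  symm
  refine Finset.sum_subset (Finset.range_subset_range.2 (by omega)) fun m _ hm => ?_
  rw [outsideProb, if_neg (by rw [Finset.mem_range] at hm; omega), mul_zero]

/-! ### The interface states as product states -/

/-- The occupation probability at height `h` in the grand canonical state. -/
def occProb (q μ : ℝ) (h : ℤ) : ℝ :=
  q ^ (2 * ((h : ℝ) - μ)) / (1 + q ^ (2 * ((h : ℝ) - μ)))

theorem occProb_pos {q : ℝ} (hq : 0 < q) (μ : ℝ) (h : ℤ) : 0 < occProb q μ h := by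
  have := Real.rpow_pos_of_pos hq (2 * ((h : ℝ) - μ))
  unfold occProb
  positivity

theorem one_sub_occProb {q : ℝ} (hq : 0 < q) (μ : ℝ) (h : ℤ) :
    1 - occProb q μ h = 1 / (1 + q ^ (2 * ((h : ℝ) - μ))) := by
  have := Real.rpow_pos_of_pos hq (2 * ((h : ℝ) - μ))
  unfold occProb
  field_simp
  ring

theorem occProb_lt_one {q : ℝ} (hq : 0 < q) (μ : ℝ) (h : ℤ) : occProb q μ h < 1 := by
  have := Real.rpow_pos_of_pos hq (2 * ((h : ℝ) - μ))
  have h1 := one_sub_occProb hq μ h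
  have h2 : 0 < 1 / (1 + q ^ (2 * ((h : ℝ) - μ))) := by positivity
  linarith

/-- The occupation probability at a site in the grand canonical state. -/
def siteProb (q μ : ℝ) (x : Site) : ℝ := occProb q μ (height x)

theorem siteProb_mem {q : ℝ} (hq : 0 < q) (μ : ℝ) (x : Site) :
    0 < siteProb q μ x ∧ siteProb q μ x < 1 :=
  ⟨occProb_pos hq μ _, occProb_lt_one hq μ _⟩

theorem sqrt_siteProb {q : ℝ} (hq : 0 < q) (μ : ℝ) (x : Site) :
    √(siteProb q μ x) = q ^ ((height x : ℝ) - μ) * √(1 - siteProb q μ x) := by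
  have h1 := Real.rpow_pos_of_pos hq ((height x : ℝ) - μ)
  have h2 : q ^ (2 * ((height x : ℝ) - μ)) = (q ^ ((height x : ℝ) - μ)) ^ 2 := by
    rw [← Real.rpow_natCast, ← Real.rpow_mul hq.le, mul_comm]
    norm_num
  have h3 : siteProb q μ x = (q ^ ((height x : ℝ) - μ)) ^ 2 * (1 - siteProb q μ x) := by
    rw [siteProb, one_sub_occProb hq, occProb, h2]
    ring
  conv_lhs => rw [h3]
  rw [Real.sqrt_mul (sq_nonneg _), Real.sqrt_sq h1.le]

theorem prod_ite_eq_productAmp {q : ℝ} (hq : 0 < q) (μ : ℝ) {Λ : Finset Site} (α : Config Λ) :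
    ∏ x : ↥Λ, (if α x = 1 then q ^ ((height x.1 : ℝ) - μ) else 1) =
      (∏ x : ↥Λ, √(1 - siteProb q μ x))⁻¹ * productAmp (siteProb q μ) α := by
  rw [productAmp, ← Finset.prod_inv_distrib, ← Finset.prod_mul_distrib]
  refine Finset.prod_congr rfl fun x _ => ?_
  have h : √(1 - siteProb q μ x) ≠ 0 :=
    (Real.sqrt_pos.2 (sub_pos.2 (siteProb_mem hq μ x).2)).ne'
  split_ifs
  · rw [sqrt_siteProb hq]
    field_simp
  · rw [inv_mul_cancel₀ h]

theorem prod_sqrt_inv_ne_zero {q : ℝ} (hq : 0 < q) (μ : ℝ) (Λ : Finset Site) :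
    (∏ x : ↥Λ, √(1 - siteProb q μ x))⁻¹ ≠ 0 :=
  inv_ne_zero (Finset.prod_ne_zero_iff.2 fun x _ =>
    (Real.sqrt_pos.2 (sub_pos.2 (siteProb_mem hq μ x).2)).ne')

theorem gcExp_eq_expectation_productAmp {q : ℝ} (hq : 0 < q) (μ : ℝ) (Λ : Finset Site)
    (X : Observable Λ) :
    gcExp q Λ μ X = expectation (fun α => (productAmp (siteProb q μ) α : ℂ)) X := by
  have h : gcState q Λ μ = (((∏ x : ↥Λ, √(1 - siteProb q μ x))⁻¹ : ℝ) : ℂ) •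
      fun α : Config Λ => (productAmp (siteProb q μ) α : ℂ) := by
    funext α
    rw [gcState, prod_ite_eq_productAmp hq]
    simp
  rw [gcExp, h, expectation_smul]
  exact_mod_cast prod_sqrt_inv_ne_zero hq μ Λ

/-- Every `μ` is admissible: on the `n`-particle sector the chemical potential contributes only the
constant factor `q ^ (-μ n)`. -/
theorem canonicalExp_eq_expectation_sectorState {q : ℝ} (hq : 0 < q) (μ : ℝ) (Λ : Finset Site)
    (n : ℕ) (X : Observable Λ) :
    canonicalExp q Λ n X = expectation (sectorState (siteProb q μ) Λ n) X := by
  have hqμ := Real.rpow_pos_of_pos hq μ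
  have hprod : ∀ α : Config Λ, ∏ x, q ^ (height x.1 * ((α x : ℕ) : ℤ)) =
      (q ^ μ) ^ numParticles α *
        ∏ x : ↥Λ, (if α x = 1 then q ^ ((height x.1 : ℝ) - μ) else 1) := by
    intro α
    rw [numParticles, ← Finset.prod_pow_eq_pow_sum, ← Finset.prod_mul_distrib]
    refine Finset.prod_congr rfl fun x _ => ?_
    rw [coe_fin_two_eq_ite (α x)]
    split_ifs
    · rw [Real.rpow_sub hq, Real.rpow_intCast]
      field_simp
      simp
    · simp
  have h : canonicalState q Λ n =
      (((q ^ μ) ^ n * (∏ x : ↥Λ, √(1 - siteProb q μ x))⁻¹ : ℝ) : ℂ) •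
        sectorState (siteProb q μ) Λ n := by
    funext α
    simp only [canonicalState, sectorState, Pi.smul_apply, smul_eq_mul]
    split_ifs with hα
    · rw [hprod, prod_ite_eq_productAmp hq, hα]
      push_cast
      ring
    · simp
  rw [canonicalExp, h, expectation_smul]
  exact_mod_cast mul_ne_zero (pow_ne_zero _ hqμ.ne') (prod_sqrt_inv_ne_zero hq μ Λ)

/-- Comparison of the canonical and grand canonical expectations in terms of the law of the
particle numbers in `Λ₀` and in its complement. -/
theorem norm_canonicalExp_sub_gcExp_le {q : ℝ} (hq : 0 < q) (μ : ℝ) {Λ₀ Λ : Finset Site}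
    (h : Λ₀ ⊆ Λ) {X : Observable Λ₀} (hX : Commute X (totalSpin3 Λ₀)) {n : ℕ}
    (hn : n ≤ Λ.card) :
    ‖canonicalExp q Λ n (ampliation h X) - gcExp q Λ₀ μ X‖ ≤
      (∑ m ∈ Finset.range (Λ₀.card + 1), (bernoulliGF (siteProb q μ) Λ₀).coeff m *
        |outsideProb (siteProb q μ) (Λ \ Λ₀) n m - (bernoulliGF (siteProb q μ) Λ).coeff n|) /
        (bernoulliGF (siteProb q μ) Λ).coeff n * gsNorm q Λ₀ X := by
  set p := siteProb q μ with hp'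
  have hp : ∀ x, 0 < p x ∧ p x < 1 := siteProb_mem hq μ
  have hcons : ∀ α β, numParticles α ≠ numParticles β → X α β = 0 :=
    fun α β => apply_eq_zero_of_commute_totalSpin3 hX
  set P := (bernoulliGF p Λ).coeff n with hP
  have hP0 : 0 < P := coeff_bernoulliGF_pos hp hn
  have hPC : (P : ℂ) ≠ 0 := by exact_mod_cast hP0.ne'
  rw [gcExp_eq_expectation_productAmp hq, expectation_productAmp hp hcons,
    canonicalExp_eq_expectation_sectorState hq μ, expectation_sectorState hp,
    sectorNum_ampliation hp h hcons, Finset.sum_div, ← Finset.sum_sub_distrib, Finset.sum_div,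
    Finset.sum_mul]
  refine (norm_sum_le _ _).trans (Finset.sum_le_sum fun m hm => ?_)
  rw [Finset.mem_range] at hm
  have hc0 : 0 < (bernoulliGF p Λ₀).coeff m := coeff_bernoulliGF_pos hp (by omega)
  have hcC : (((bernoulliGF p Λ₀).coeff m : ℝ) : ℂ) ≠ 0 := by exact_mod_cast hc0.ne'
  -- The same sector expectations of `Λ₀` enter both ensembles; only their weights differ.
  have hnum : sectorNum p m X = (((bernoulliGF p Λ₀).coeff m : ℝ) : ℂ) * canonicalExp q Λ₀ m X := by
    rw [canonicalExp_eq_expectation_sectorState hq μ, expectation_sectorState hp,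
      mul_div_cancel₀ _ hcC]
  have hgs : ‖canonicalExp q Λ₀ m X‖ ≤ gsNorm q Λ₀ X :=
    le_ciSup (f := fun k : Fin (Λ₀.card + 1) => ‖canonicalExp q Λ₀ k X‖)
      (Set.finite_range _).bddAbove ⟨m, hm⟩
  have heq : (outsideProb p (Λ \ Λ₀) n m : ℂ) * sectorNum p m X / (P : ℂ) - sectorNum p m X =
      (((bernoulliGF p Λ₀).coeff m * (outsideProb p (Λ \ Λ₀) n m - P) / P : ℝ) : ℂ) *
        canonicalExp q Λ₀ m X := by
    rw [hnum]
    push_cast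
    field_simp
  rw [heq, norm_mul, Complex.norm_real, Real.norm_eq_abs, abs_div, abs_mul, abs_of_pos hc0,
    abs_of_pos hP0]
  gcongr

/-! ### Sums over sticks and cylinders -/

/-- The heights of the sites of the stick. -/
def heights (L : ℕ) : Finset ℤ := Finset.Icc (-((L : ℤ) / 2)) ((L : ℤ) / 2)

theorem card_heights {L : ℕ} (hL : Even L) : (heights L).card = L + 1 := by
  obtain ⟨k, rfl⟩ := hL
  rw [heights, Int.card_Icc]
  omega

theorem zero_mem_heights (L : ℕ) : (0 : ℤ) ∈ heights L := by
  rw [heights, Finset.mem_Icc]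
  omega

theorem stickSite_injective : Function.Injective stickSite :=
  Function.LeftInverse.injective height_stickSite

theorem height_add (x y : Site) : height (x + y) = height x + height y := by
  simp only [height, Pi.add_apply]
  ring

theorem sum_stick (L : ℕ) (F : ℤ → ℝ) :
    ∑ x ∈ stick L, F (height x) = ∑ j ∈ heights L, F j := by
  rw [stick, Finset.sum_image fun _ _ _ _ h => stickSite_injective h, heights]
  simp only [height_stickSite]

/-- Base points have height zero, so the height of the sum determines the stick site and hence the
base point. -/
theorem injOn_cylinder {L : ℕ} {Γ : Finset Site} (hΓ : ∀ x ∈ Γ, height x = 0) :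
    Set.InjOn (fun p : Site × Site => p.1 + p.2) (Γ ×ˢ stick L : Finset (Site × Site)) := by
  rintro ⟨x, y⟩ hxy ⟨x', y'⟩ hxy' h
  simp only [Finset.coe_product, Set.mem_prod, Finset.mem_coe] at hxy hxy'
  have h1 := congrArg height h
  simp only [height_add, hΓ x hxy.1, hΓ x' hxy'.1, zero_add] at h1
  obtain ⟨⟨i, -, rfl⟩, ⟨j, -, rfl⟩⟩ :=
    And.intro (Finset.mem_image.1 hxy.2) (Finset.mem_image.1 hxy'.2)
  rw [height_stickSite, height_stickSite] at h1
  subst h1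
  simpa using h

theorem sum_cylinder {L : ℕ} {Γ : Finset Site} (hΓ : ∀ x ∈ Γ, height x = 0) (F : ℤ → ℝ) :
    ∑ x ∈ cylinder L Γ, F (height x) = Γ.card * ∑ j ∈ heights L, F j := by
  rw [cylinder, Finset.sum_image (injOn_cylinder hΓ), Finset.sum_product]
  have h : ∀ x ∈ Γ, ∑ y ∈ stick L, F (height (x + y)) = ∑ j ∈ heights L, F j := by
    intro x hx
    simp only [height_add, hΓ x hx, zero_add]
    exact sum_stick L F
  rw [Finset.sum_congr rfl h, Finset.sum_const, nsmul_eq_mul]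

theorem card_cylinder {L : ℕ} (hL : Even L) {Γ : Finset Site} (hΓ : ∀ x ∈ Γ, height x = 0) :
    ((cylinder L Γ).card : ℝ) = Γ.card * (L + 1) := by
  have h := sum_cylinder (L := L) hΓ fun _ => 1
  simp only [Finset.sum_const, nsmul_eq_mul, mul_one, card_heights hL] at h
  exact_mod_cast h

/-! ### The chemical potential -/

/-- Read off from the second moments about `0` and `1`, since `2k = k² - (k-1)² + 1`. -/
theorem sum_coeff_mul_bernoulliGF {ι : Type*} (p : ι → ℝ) (s : Finset ι) :
    ∑ k ∈ Finset.range (s.card + 1), (bernoulliGF p s).coeff k * (k : ℝ) = ∑ i ∈ s, p i := by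
  have h : ∀ y : ℝ, ∑ k ∈ Finset.range (s.card + 1),
      (bernoulliGF p s).coeff k * ((k : ℝ) - y) ^ 2 =
      bernoulliVar p s + (∑ i ∈ s, p i - y) ^ 2 := fun y => by
    rw [← coeffPairing_sq_bernoulliGF, coeffPairing_eq_sum_range _ (natDegree_bernoulliGF_le p s)]
  have h1 : ∑ k ∈ Finset.range (s.card + 1), (bernoulliGF p s).coeff k * (k : ℝ) =
      (∑ k ∈ Finset.range (s.card + 1), (bernoulliGF p s).coeff k * ((k : ℝ) - 0) ^ 2 -
        ∑ k ∈ Finset.range (s.card + 1), (bernoulliGF p s).coeff k * ((k : ℝ) - 1) ^ 2 +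
        ∑ k ∈ Finset.range (s.card + 1), (bernoulliGF p s).coeff k) / 2 := by
    rw [← Finset.sum_sub_distrib, ← Finset.sum_add_distrib, Finset.sum_div]
    refine Finset.sum_congr rfl fun k _ => ?_
    ring
  rw [h1, h, h, sum_coeff_bernoulliGF]
  ring

theorem gcExp_numberOp {q : ℝ} (hq : 0 < q) (μ : ℝ) (Λ : Finset Site) :
    gcExp q Λ μ (numberOp Λ) = ((∑ x ∈ Λ, siteProb q μ x : ℝ) : ℂ) := by
  have hp := siteProb_mem hq μ
  rw [gcExp_eq_expectation_productAmp hq, expectation_productAmp hp, ← sum_coeff_mul_bernoulliGF,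
    Complex.ofReal_sum]
  · refine Finset.sum_congr rfl fun m _ => ?_
    have h : numberOp Λ *ᵥ sectorState (siteProb q μ) Λ m =
        (m : ℂ) • sectorState (siteProb q μ) Λ m := by
      funext α
      rw [numberOp, mulVec_diagonal]
      by_cases hα : numParticles α = m <;> simp [sectorState, hα]
    rw [sectorNum, h, dotProduct_smul, star_sectorState_dotProduct hp, smul_eq_mul]
    push_cast
    ring
  · intro α β h
    rw [numberOp, diagonal_apply_ne]
    exact fun h' => h (by rw [h'])

/-- The mean particle number on the stick in the grand canonical state. -/
def meanNumber (q : ℝ) (L : ℕ) (μ : ℝ) : ℝ := ∑ j ∈ heights L, occProb q μ j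

theorem isChemicalPotential_iff {q : ℝ} (hq : 0 < q) (L : ℕ) (ρ μ : ℝ) :
    IsChemicalPotential q L ρ μ ↔ meanNumber q L μ = ρ * (L + 1) := by
  rw [IsChemicalPotential, gcExp_numberOp hq, Complex.ofReal_inj, meanNumber]
  unfold siteProb
  rw [sum_stick L (occProb q μ)]

theorem strictMono_occProb {q : ℝ} (hq₀ : 0 < q) (hq₁ : q < 1) (h : ℤ) :
    StrictMono fun μ => occProb q μ h := by
  intro μ ν hμν
  have h1 := Real.rpow_pos_of_pos hq₀ (2 * ((h : ℝ) - μ))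
  have h2 : q ^ (2 * ((h : ℝ) - μ)) < q ^ (2 * ((h : ℝ) - ν)) :=
    Real.rpow_lt_rpow_of_exponent_gt hq₀ hq₁ (by linarith)
  simp only [occProb]
  rw [div_lt_div_iff₀ (by linarith) (by linarith)]
  linarith

theorem strictMono_meanNumber {q : ℝ} (hq₀ : 0 < q) (hq₁ : q < 1) (L : ℕ) :
    StrictMono (meanNumber q L) := fun _ _ h =>
  Finset.sum_lt_sum_of_nonempty ⟨0, zero_mem_heights L⟩ fun j _ =>
    strictMono_occProb hq₀ hq₁ j h

/-- Particle-hole symmetry combined with reflection of the heights. -/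
theorem occProb_neg {q : ℝ} (hq : 0 < q) (μ : ℝ) (h : ℤ) :
    occProb q (-μ) (-h) = 1 - occProb q μ h := by
  have h1 := Real.rpow_pos_of_pos hq (2 * ((h : ℝ) - μ))
  have h2 : q ^ (2 * (((-h : ℤ) : ℝ) - -μ)) = (q ^ (2 * ((h : ℝ) - μ)))⁻¹ := by
    rw [← Real.rpow_neg hq.le]
    congr 1
    push_cast
    ring
  rw [one_sub_occProb hq, occProb, h2]
  field_simp
  ring

theorem meanNumber_neg {q : ℝ} (hq : 0 < q) {L : ℕ} (hL : Even L) (μ : ℝ) :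
    meanNumber q L (-μ) = L + 1 - meanNumber q L μ := by
  have h : meanNumber q L (-μ) = ∑ j ∈ heights L, occProb q (-μ) (-j) := by
    rw [meanNumber]
    have hmem : ∀ j ∈ heights L, -j ∈ heights L := by
      intro j hj
      rw [heights, Finset.mem_Icc] at hj ⊢
      omega
    exact Finset.sum_nbij' (fun j => -j) (fun j => -j) hmem hmem (fun j _ => neg_neg j)
      (fun j _ => neg_neg j) fun j _ => by rw [neg_neg]
  rw [h]
  simp_rw [occProb_neg hq]
  rw [Finset.sum_sub_distrib, Finset.sum_const, card_heights hL, meanNumber]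
  simp

theorem continuous_meanNumber {q : ℝ} (hq : 0 < q) (L : ℕ) : Continuous (meanNumber q L) := by
  unfold meanNumber occProb
  refine continuous_finsetSum _ fun j _ => ?_
  have h : Continuous fun μ : ℝ => q ^ (2 * ((j : ℝ) - μ)) :=
    Continuous.rpow continuous_const (by fun_prop) fun _ => Or.inl hq.ne'
  refine h.div (by fun_prop) fun μ => ?_
  have := Real.rpow_pos_of_pos hq (2 * ((j : ℝ) - μ))
  positivity

theorem exists_meanNumber_le {q : ℝ} (hq₀ : 0 < q) (hq₁ : q < 1) (L : ℕ) {c : ℝ} (hc : 0 < c) :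
    ∃ μ, meanNumber q L μ ≤ c := by
  have h : Filter.Tendsto (meanNumber q L) Filter.atBot (nhds (∑ j ∈ heights L, (0 : ℝ))) := by
    refine tendsto_finsetSum _ fun j _ => ?_
    have h1 : Filter.Tendsto (fun μ : ℝ => 2 * ((j : ℝ) - μ)) Filter.atBot Filter.atTop := by
      refine Filter.Tendsto.const_mul_atTop (by norm_num) ?_
      exact Filter.tendsto_atTop_add_const_left _ _ Filter.tendsto_neg_atBot_atTop
    have h2 : Filter.Tendsto (fun μ : ℝ => q ^ (2 * ((j : ℝ) - μ))) Filter.atBot (nhds 0) :=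
      (tendsto_rpow_atTop_of_base_lt_one q (by linarith) hq₁).comp h1
    have h3 := h2.div (h2.const_add 1) (by norm_num)
    rw [zero_div] at h3
    exact h3
  rw [Finset.sum_const_zero] at h
  obtain ⟨μ, hμ⟩ := (h.eventually (gt_mem_nhds hc)).exists
  exact ⟨μ, hμ.le⟩

/-- Intermediate values and strict monotonicity; the upper end follows from the lower one by
reflection. -/
theorem existsUnique_chemicalPotential {q : ℝ} (hq₀ : 0 < q) (hq₁ : q < 1) {L : ℕ} (hL : Even L)
    {ρ : ℝ} (hρ₀ : 0 < ρ) (hρ₁ : ρ < 1) : ∃! μ : ℝ, IsChemicalPotential q L ρ μ := by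
  simp_rw [isChemicalPotential_iff hq₀]
  have hL1 : (0 : ℝ) < L + 1 := by positivity
  obtain ⟨a, ha⟩ := exists_meanNumber_le hq₀ hq₁ L (mul_pos hρ₀ hL1)
  obtain ⟨b, hb⟩ := exists_meanNumber_le hq₀ hq₁ L (mul_pos (sub_pos.2 hρ₁) hL1)
  obtain ⟨μ, hμ⟩ := mem_range_of_exists_le_of_exists_ge (continuous_meanNumber hq₀ L) ⟨a, ha⟩
    ⟨-b, by rw [meanNumber_neg hq₀ hL]; linarith⟩
  exact ⟨μ, hμ, fun ν hν => (strictMono_meanNumber hq₀ hq₁ L).injective (hν.trans hμ.symm)⟩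

theorem chemicalPotential_eq_zero {q : ℝ} (hq₀ : 0 < q) (hq₁ : q < 1) {L : ℕ} (hL : Even L)
    {μ : ℝ} (hμ : IsChemicalPotential q L (1 / 2) μ) : μ = 0 := by
  rw [isChemicalPotential_iff hq₀] at hμ
  have h := meanNumber_neg hq₀ hL 0
  rw [neg_zero] at h
  exact (strictMono_meanNumber hq₀ hq₁ L).injective (by linarith)

/-! ### The variance of the particle number -/

/-- The variance of the particle number on the stick in the grand canonical state. -/
def stickVar (q : ℝ) (L : ℕ) (μ : ℝ) : ℝ := bernoulliVar (occProb q μ) (heights L)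

theorem occProb_mul_pos {q : ℝ} (hq : 0 < q) (μ : ℝ) (j : ℤ) :
    0 < occProb q μ j * (1 - occProb q μ j) :=
  mul_pos (occProb_pos hq μ j) (sub_pos.2 (occProb_lt_one hq μ j))

theorem stickVar_pos {q : ℝ} (hq : 0 < q) (L : ℕ) (μ : ℝ) : 0 < stickVar q L μ :=
  Finset.sum_pos (fun j _ => occProb_mul_pos hq μ j) ⟨0, zero_mem_heights L⟩

theorem bernoulliVar_cylinder {q : ℝ} {L : ℕ} {Γ : Finset Site} (hΓ : ∀ x ∈ Γ, height x = 0)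
    (μ : ℝ) : bernoulliVar (siteProb q μ) (cylinder L Γ) = Γ.card * stickVar q L μ :=
  sum_cylinder hΓ fun j => occProb q μ j * (1 - occProb q μ j)

theorem bernoulliVar_sdiff {ι : Type*} [DecidableEq ι] (p : ι → ℝ) {s t : Finset ι} (h : s ⊆ t) :
    bernoulliVar p (t \ s) = bernoulliVar p t - bernoulliVar p s := by
  have := Finset.sum_sdiff h (f := fun i => p i * (1 - p i))
  unfold bernoulliVar
  linarith

theorem half_le_occProb_iff {q : ℝ} (hq : 0 < q) (μ : ℝ) (j : ℤ) :
    1 / 2 ≤ occProb q μ j ↔ 1 ≤ q ^ (2 * ((j : ℝ) - μ)) := by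
  have := Real.rpow_pos_of_pos hq (2 * ((j : ℝ) - μ))
  rw [occProb, div_le_div_iff₀ (by norm_num) (by linarith)]
  constructor <;> intro h <;> linarith

/-- If the occupation probability crosses `1/2` inside the stick, then the stick has a site of
large variance. -/
theorem sq_div_four_le_stickVar {q : ℝ} (hq₀ : 0 < q) (hq₁ : q < 1) {L : ℕ} {μ : ℝ} {a b : ℤ}
    (ha : a ∈ heights L) (hb : b ∈ heights L) (hpa : 1 / 2 ≤ occProb q μ a)
    (hpb : occProb q μ b < 1 / 2) : q ^ 2 / 4 ≤ stickVar q L μ := by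
  classical
  set S := (heights L).filter fun j => 1 / 2 ≤ occProb q μ j with hS
  have hSne : S.Nonempty := ⟨a, Finset.mem_filter.2 ⟨ha, hpa⟩⟩
  set j := S.max' hSne with hj
  obtain ⟨hjL, hpj⟩ := Finset.mem_filter.1 (S.max'_mem hSne)
  -- Here `j` is the last height with occupation at least `1/2`, so `u ≥ 1` and `q²u < 1` below,
  -- whence `u/(1+u)² ≥ 1/(4u) ≥ q²/4`.
  rw [← hj] at hjL hpj
  have hu1 := (half_le_occProb_iff hq₀ μ j).1 hpj
  have hjb : j < b := by
    by_contra hcon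
    have hbj : (b : ℝ) ≤ j := by exact_mod_cast not_lt.1 hcon
    refine absurd ((half_le_occProb_iff hq₀ μ b).2 (hu1.trans ?_)) (not_le.2 hpb)
    exact Real.rpow_le_rpow_of_exponent_ge hq₀ hq₁.le (by linarith)
  have hj1 : j + 1 ∈ heights L := by
    rw [heights, Finset.mem_Icc] at hjL hb ⊢
    omega
  have hu2 : ¬ 1 ≤ q ^ (2 * (((j + 1 : ℤ) : ℝ) - μ)) := by
    rw [← half_le_occProb_iff hq₀]
    intro h
    have := S.le_max' (j + 1) (Finset.mem_filter.2 ⟨hj1, h⟩)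
    omega
  set u := q ^ (2 * ((j : ℝ) - μ)) with hu
  have hshift : q ^ (2 * (((j + 1 : ℤ) : ℝ) - μ)) = q ^ 2 * u := by
    rw [hu, ← Real.rpow_natCast q 2, ← Real.rpow_add hq₀]
    congr 1
    push_cast
    ring
  rw [hshift, not_le] at hu2
  have hterm : q ^ 2 / 4 ≤ occProb q μ j * (1 - occProb q μ j) := by
    rw [one_sub_occProb hq₀, occProb, ← hu, div_mul_div_comm, mul_one,
      div_le_div_iff₀ (by norm_num) (by positivity)]
    have hq2 : 0 < q ^ 2 := by positivity
    have h1 : (1 + u) * (1 + u) ≤ 4 * (u * u) := by nlinarith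
    have h2 := mul_le_mul_of_nonneg_left h1 hq2.le
    have h3 : q ^ 2 * u * u ≤ 1 * u := mul_le_mul_of_nonneg_right hu2.le (by linarith)
    linarith
  exact hterm.trans (Finset.single_le_sum (f := fun j => occProb q μ j * (1 - occProb q μ j))
    (fun k _ => (occProb_mul_pos hq₀ μ k).le) hjL)

/-- If all occupations are below `1/2`, the variance is at least half the number of particles; if
all are at least `1/2`, half the number of holes; otherwise a crossing site contributes `q²/4`. -/
theorem half_le_mul_stickVar {q : ℝ} (hq₀ : 0 < q) (hq₁ : q < 1) {L : ℕ} (hL : Even L)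
    {μ A : ℝ} (hA : 4 ≤ A * q ^ 2) (hmean : 1 ≤ A * meanNumber q L μ)
    (hmean' : A * meanNumber q L μ + 1 ≤ A * (L + 1)) : 1 / 2 ≤ A * stickVar q L μ := by
  have hq2 : 0 < q ^ 2 := by positivity
  have hA0 : 0 < A := (mul_pos_iff_of_pos_right hq2).1 (by linarith)
  by_cases h1 : ∀ j ∈ heights L, occProb q μ j < 1 / 2
  · have : 1 / 2 * meanNumber q L μ ≤ stickVar q L μ := by
      rw [meanNumber, Finset.mul_sum]
      refine Finset.sum_le_sum fun j hj => ?_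
      nlinarith [h1 j hj, occProb_pos hq₀ μ j]
    nlinarith
  · by_cases h2 : ∀ j ∈ heights L, 1 / 2 ≤ occProb q μ j
    · have h3 : 1 / 2 * (L + 1 - meanNumber q L μ) ≤ stickVar q L μ := by
        have h4 : (L : ℝ) + 1 - meanNumber q L μ = ∑ j ∈ heights L, (1 - occProb q μ j) := by
          rw [Finset.sum_sub_distrib, Finset.sum_const, card_heights hL, meanNumber]
          simp
        rw [h4, Finset.mul_sum]
        refine Finset.sum_le_sum fun j hj => ?_
        nlinarith [h2 j hj, occProb_lt_one hq₀ μ j]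
      nlinarith
    · push Not at h1 h2
      obtain ⟨a, ha, hpa⟩ := h1
      obtain ⟨b, hb, hpb⟩ := h2
      have := sq_div_four_le_stickVar hq₀ hq₁ ha hb hpa hpb
      nlinarith

/-! ### The error term -/

theorem pi_div_centralConst_le : Real.pi / (4 * centralConst) ≤ 2.4 := by
  have h1 : Real.exp 1 < 2.72 := by linarith [Real.exp_one_lt_d9]
  have h0 := Real.exp_pos 1
  have h2 := Real.pi_lt_d2
  have h3 := Real.pi_gt_d2
  have h4 : (2.5 : ℝ) ≤ √(2 * Real.pi) := Real.le_sqrt_of_sq_le (by norm_num at h3 ⊢; linarith)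
  have h5 : (2.5 : ℝ) / 2.72 ^ 2 ≤ centralConst := by
    unfold centralConst
    gcongr
  have h6 := centralConst_pos
  rw [div_le_iff₀ (by positivity)]
  norm_num at h2 h5 ⊢
  linarith

/-- From `B > 4A₀²` and `A₀ ≥ 1`, `A₀(B + A₀) ≤ (5/4) A₀ B ≤ 1.44 A₀² B`. -/
theorem sqrt_div_le {A₀ B : ℝ} (hA₀ : 1 ≤ A₀) (hB : 2 * A₀ < √B) :
    √(A₀ * (B + A₀)) / B ≤ 1.2 * (A₀ / √B) := by
  have hs : 0 < √B := by linarith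
  have hB0 : 0 < B := Real.sqrt_pos.1 hs
  have hBs : √B ^ 2 = B := Real.sq_sqrt hB0.le
  have h1 : √(A₀ * (B + A₀)) ≤ 1.2 * A₀ * √B := by
    refine Real.sqrt_le_iff.2 ⟨by positivity, ?_⟩
    rw [mul_pow, hBs]
    have h2 : A₀ ≤ B / 4 := by nlinarith
    nlinarith [mul_le_mul_of_nonneg_left h2 (by linarith : 0 ≤ A₀),
      mul_nonneg (by linarith : 0 ≤ A₀ - 1) (mul_nonneg (by linarith : 0 ≤ A₀) hB0.le)]
  rw [div_le_iff₀ hB0]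
  refine h1.trans (le_of_eq ?_)
  nth_rewrite 3 [← hBs]
  field_simp

/-- The logarithmic term is nonnegative and `q²√(A - A₀) - 2A₀ ≤ √(A - A₀)`, so the estimate to be
proved is stronger than `ε`. -/
theorem four_mul_div_sqrt_le_errorBound {q A A₀ : ℝ} (hq₀ : 0 < q) (hq₁ : q < 1) (hA₀ : 0 ≤ A₀)
    (hA : 2 * A₀ < q ^ 2 * √(A - A₀)) : 4 * (A₀ / √(A - A₀)) ≤ errorBound q A A₀ := by
  have hq2 : q ^ 2 ≤ 1 := pow_le_one₀ hq₀.le hq₁.le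
  have hs : 0 < √(A - A₀) := (mul_pos_iff_of_pos_left (pow_pos hq₀ 2)).1 (by linarith)
  have hB : 0 < A - A₀ := Real.sqrt_pos.1 hs
  have h1 : 4 * A₀ / √(A - A₀) ≤ 4 * A₀ / (q ^ 2 * √(A - A₀) - 2 * A₀) := by
    refine div_le_div_of_nonneg_left (by positivity) (by linarith) ?_
    nlinarith
  have h2 : 0 ≤ (Real.log (A - A₀) ^ 2 + 2 * (1 + (2 * |Real.log q|) ^ 2) * A₀ ^ 2 + 4) /
      (2 * (A - A₀)) := by positivity
  rw [errorBound, ← mul_div_assoc]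
  linarith

/-- The total variation estimate behind the equivalence of ensembles. -/
theorem sum_outsideProb_div_le_errorBound {q : ℝ} (hq₀ : 0 < q) (hq₁ : q < 1) {L : ℕ}
    (hL : Even L) {Γ₀ Γ : Finset Site} (hΓ₀ : ∀ x ∈ Γ₀, height x = 0)
    (hΓ : ∀ x ∈ Γ, height x = 0) (hsub : cylinder L Γ₀ ⊆ cylinder L Γ)
    (hA : 2 * (Γ₀.card : ℝ) < q ^ 2 * √((Γ.card : ℝ) - Γ₀.card)) {n : ℕ} (hn₀ : 0 < n)
    (hn₁ : n < (cylinder L Γ).card) {μ : ℝ} (hμ : (Γ.card : ℝ) * meanNumber q L μ = n) :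
    (∑ m ∈ Finset.range ((cylinder L Γ₀).card + 1),
      (bernoulliGF (siteProb q μ) (cylinder L Γ₀)).coeff m *
        |outsideProb (siteProb q μ) (cylinder L Γ \ cylinder L Γ₀) n m -
          (bernoulliGF (siteProb q μ) (cylinder L Γ)).coeff n|) /
      (bernoulliGF (siteProb q μ) (cylinder L Γ)).coeff n ≤ errorBound q Γ.card Γ₀.card := by
  set p := siteProb q μ with hp'
  set A : ℝ := (Γ.card : ℝ) with hAdef
  set A₀ : ℝ := (Γ₀.card : ℝ) with hA₀def
  have hA₀0 : 0 ≤ A₀ := Nat.cast_nonneg _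
  have hp : ∀ x, 0 < p x ∧ p x < 1 := siteProb_mem hq₀ μ
  have hp01 : ∀ x, 0 ≤ p x ∧ p x ≤ 1 := fun x => ⟨(hp x).1.le, (hp x).2.le⟩
  have hq2 : q ^ 2 ≤ 1 := pow_le_one₀ hq₀.le hq₁.le
  have hs : 0 < √(A - A₀) := (mul_pos_iff_of_pos_left (pow_pos hq₀ 2)).1 (by linarith)
  have hB : 0 < A - A₀ := Real.sqrt_pos.1 hs
  have hv := stickVar_pos hq₀ L μ
  set v := stickVar q L μ with hvdef
  have hV : bernoulliVar p (cylinder L Γ) = A * v := bernoulliVar_cylinder hΓ μ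
  have hV₀ : bernoulliVar p (cylinder L Γ₀) = A₀ * v := bernoulliVar_cylinder hΓ₀ μ
  have hVc : bernoulliVar p (cylinder L Γ \ cylinder L Γ₀) = (A - A₀) * v := by
    rw [bernoulliVar_sdiff p hsub, hV, hV₀]
    ring
  have hP0 : 0 < (bernoulliGF p (cylinder L Γ)).coeff n := coeff_bernoulliGF_pos hp hn₁.le
  have hosc := sum_coeff_mul_abs_sub_le (s := cylinder L Γ₀) (fun x _ => hp01 x)
    (s' := cylinder L Γ \ cylinder L Γ₀) (fun x _ => hp01 x) (by rw [hVc]; positivity) n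
    (outsideProb p (cylinder L Γ \ cylinder L Γ₀) n) (fun m => rfl) _
    (sum_coeff_mul_outsideProb p hsub n)
  rw [hVc, hV₀] at hosc
  refine le_trans ?_ (four_mul_div_sqrt_le_errorBound hq₀ hq₁ hA₀0 hA)
  -- For an empty base the oscillation vanishes. Otherwise `A₀ ≥ 1` makes `A` large enough for the
  -- variance bound.
  rcases Nat.eq_zero_or_pos Γ₀.card with h0 | h0
  · have hA₀z : A₀ = 0 := by rw [hA₀def, h0, Nat.cast_zero]
    rw [hA₀z, zero_mul, Real.sqrt_zero, mul_zero] at hosc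
    rw [hA₀z, zero_div, mul_zero]
    exact div_nonpos_of_nonpos_of_nonneg hosc hP0.le
  · have hA₀1 : 1 ≤ A₀ := Nat.one_le_cast.2 h0
    have hsA : 2 * A₀ < √(A - A₀) := hA.trans_le (mul_le_of_le_one_left hs.le hq2)
    have hAq : 4 ≤ A * q ^ 2 := by
      have h1 := Real.sq_sqrt hB.le
      nlinarith
    have hn0 : (1 : ℝ) ≤ n := by exact_mod_cast hn₀
    have hn1 : (n : ℝ) + 1 ≤ A * (L + 1) := by
      rw [← card_cylinder hL hΓ]
      exact_mod_cast hn₁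
    have hVhalf : 1 / 2 ≤ A * v :=
      half_le_mul_stickVar hq₀ hq₁ hL hAq (by rw [hμ]; exact hn0) (by rw [hμ]; exact hn1)
    have hmean : ∑ x ∈ cylinder L Γ, p x = n := by
      rw [← hμ]
      exact sum_cylinder hΓ (occProb q μ)
    have hcentral := centralConst_div_sqrt_le_coeff (s := cylinder L Γ) (fun x _ => hp01 x) hmean
      (by rw [hV]; exact hVhalf)
    rw [hV] at hcentral
    have hc := centralConst_pos
    have hA0 : 0 < A := by linarith
    have hK := pi_div_centralConst_le
    calc _ ≤ Real.pi / (4 * ((A - A₀) * v)) * √(A₀ * v) / (centralConst / √(A * v)) :=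
          div_le_div₀ (by have := Real.pi_pos; positivity) hosc (by positivity) hcentral
      -- The stick variance `v` cancels here, which makes the bound uniform in `L` and `μ`.
      _ = Real.pi / (4 * centralConst) * (√(A₀ * ((A - A₀) + A₀)) / (A - A₀)) := by
          have hv2 : v = √v ^ 2 := (Real.sq_sqrt hv.le).symm
          rw [sub_add_cancel, Real.sqrt_mul hA₀0, Real.sqrt_mul hA₀0, Real.sqrt_mul hA0.le]
          have hsv : 0 < √v := Real.sqrt_pos.2 hv
          nth_rewrite 1 [hv2]
          field_simp
      _ ≤ 2.4 * (1.2 * (A₀ / √(A - A₀))) :=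
          mul_le_mul hK (sqrt_div_le hA₀1 hsA) (by positivity) (by norm_num)
      _ ≤ 4 * (A₀ / √(A - A₀)) := by
          have : 0 ≤ A₀ / √(A - A₀) := by positivity
          linarith

end

end XXZ

/-! ### The equivalence of ensembles -/

theorem mainTheorem2 (q : ℝ) (hq₀ : 0 < q) (hq₁ : q < 1) (L : ℕ) (hL : Even L)
    (Γ₀ Γ : Finset XXZ.Site)
    (hΓ₀ : ∀ x ∈ Γ₀, XXZ.height x = 0) (hΓ : ∀ x ∈ Γ, XXZ.height x = 0)
    (hsub : XXZ.cylinder L Γ₀ ⊆ XXZ.cylinder L Γ)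
    (hA : 2 * (Γ₀.card : ℝ) < q ^ 2 * √((Γ.card : ℝ) - Γ₀.card))
    (n : ℕ) (hn₀ : 0 < n) (hn₁ : n < (XXZ.cylinder L Γ).card)
    (ρ : ℝ) (hρ : ρ = (n : ℝ) / ((XXZ.cylinder L Γ).card : ℝ)) :
    (∃! μ : ℝ, XXZ.IsChemicalPotential q L ρ μ) ∧
    ∀ μ : ℝ, XXZ.IsChemicalPotential q L ρ μ →
      (∀ X : XXZ.Observable (XXZ.cylinder L Γ₀),
        Commute X (XXZ.totalSpin3 (XXZ.cylinder L Γ₀)) →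
        ‖XXZ.canonicalExp q (XXZ.cylinder L Γ) n (XXZ.ampliation hsub X)
            - XXZ.gcExp q (XXZ.cylinder L Γ₀) μ X‖
          ≤ XXZ.errorBound q Γ.card Γ₀.card * XXZ.gsNorm q (XXZ.cylinder L Γ₀) X) ∧
      (ρ = 1 / 2 → μ = 0) := by
  have hn₁' : (n : ℝ) < (XXZ.cylinder L Γ).card := by exact_mod_cast hn₁
  have hn₀' : (0 : ℝ) < n := by exact_mod_cast hn₀
  have hcard : (0 : ℝ) < (XXZ.cylinder L Γ).card := hn₀'.trans hn₁'
  refine ⟨XXZ.existsUnique_chemicalPotential hq₀ hq₁ hL (by rw [hρ]; positivity)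
    (by rw [hρ, div_lt_one hcard]; exact hn₁'), fun μ hμ => ⟨fun X hX => ?_, fun hhalf => ?_⟩⟩
  -- The condition on one stick, multiplied by the number of sticks, makes the mean over `Λ` exactly
  -- the integer `n`.
  · have hmean : (Γ.card : ℝ) * XXZ.meanNumber q L μ = n := by
      rw [(XXZ.isChemicalPotential_iff hq₀ L ρ μ).1 hμ]
      have h := XXZ.card_cylinder hL hΓ
      calc (Γ.card : ℝ) * (ρ * (L + 1)) = ρ * (Γ.card * (L + 1)) := by ring
        _ = n := by rw [← h, hρ, div_mul_cancel₀ _ hcard.ne']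
    refine (XXZ.norm_canonicalExp_sub_gcExp_le hq₀ μ hsub hX hn₁.le).trans ?_
    refine mul_le_mul_of_nonneg_right ?_ (Real.iSup_nonneg fun _ => norm_nonneg _)
    exact XXZ.sum_outsideProb_div_le_errorBound hq₀ hq₁ hL hΓ₀ hΓ hsub hA hn₀ hn₁ hmean
  · exact XXZ.chemicalPotential_eq_zero hq₀ hq₁ hL (hhalf ▸ hμ)
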